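/- Let $m\ge 1$ and $a>0$. Let $\mathbf C^{(m)}$ be the complex Clifford algebra generated by $\mathbf e_1,\dots,\mathbf e_m$ with $\mathbf e_j\mathbf e_k+\mathbf e_k\mathbf e_j=-2\delta_{jk}$, with basis $\mathbf e_T=\mathbf e_{j_1}\cdots\mathbf e_{j_l}$ ($T=\{j_1<\dots<j_l\}$), norm $|\sum_T x_T\mathbf e_T|=(\sum_T|x_T|^2)^{1/2}$ and conjugation $\overline{\sum_T x_T\mathbf e_T}=\sum_T\overline{x_T}\,\overline{\mathbf e_T}$, where $\overline{\mathbf e_T}=(-\mathbf e_{j_l})\cdots(-\mathbf e_{j_1})$. Write the points of $\mathbf R^{m+1}$ as $x=x_0+\underline x$ with $x_0\in\mathbf R$ and $\underline x=\sum_{j=1}^m x_j\mathbf e_j\in\mathbf R^m$, so that $\overline x=x_0-\underline x$, and let $S_a=\{x\in\mathbf R^{m+1}:|x_0|<a\}$. Let $A^2(S_a)$ be the space of all $C^1$ functions $f:S_a\to\mathbf C^{(m)}$ that are left-monogenic, i.e. $\partial_0f+\sum_{j=1}^m\mathbf e_j\,\partial_jf=0$ in $S_a$, and satisfy $\int_{S_a}|f|^2<\infty$.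 The space $A^2(S_a)$ has a reproducing kernel (Bergman kernel) $B(w,\overline x)$, $w,x\in S_a$: for each $x\in S_a$ the function $w\mapsto B(w,\overline x)$ belongs to $A^2(S_a)$, and $f(x)=\int_{S_a}\overline{B(w,\overline x)}\,f(w)\,dw$ for all $f\in A^2(S_a)$ and $x\in S_a$. There are constants $c,C,M>0$, independent of $w$ and $x$, with the following properties. 1. For every $x\in S_a$ the value $B(x,\overline x)$ is a real scalar and $$\frac{c}{(a-|x_0|)^{m+1}}\le B(x,\overline x)\le\frac{C}{(a-|x_0|)^{m+1}}.$$ 2. For all $w,x\in S_a$ with $|\underline w-\underline x|\ge 1$ (note that $\underline w+\overline{\underline x}=\underline w-\underline x$), $$|B(w,\overline x)|\le\frac{M}{|\underline w-\underline x|^{\frac{m-1}{2}}\,(2a-|w_0+x_0|)^{\frac{m+3}{2}}}\quad\text{if } m \text{ is odd},$$ $$|B(w,\overline x)|\le\frac{M}{|\underline w-\underline x|^{\frac{m-1}{2}}\,(2a-|w_0+x_0|)^{\frac{m+4}{2}}}\quad\text{if } m \text{ is even}.$$ -/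

import Mathlib

open scoped symmDiff

noncomputable section

namespace StripBergman

/-- The complex Clifford algebra `ℂ^(m)` generated by `e_1, …, e_m` with
`e_j e_k + e_k e_j = -2 δ_{jk}`. An element `∑_T x_T e_T` is stored as the family of its
coefficients `x_T ∈ ℂ`, where `T` runs over the subsets of `{1, …, m}` and `e_T` is the product of
the `e_j`, `j ∈ T`, in increasing order. The norm is `|x| = (∑_T |x_T|²)^{1/2}`. -/
abbrev Cl (m : ℕ) : Type := EuclideanSpace ℂ (Finset (Fin m))

/-- The sign in `e_S e_T = sgn S T • e_{S ∆ T}`: one factor `-1` for every pair `s > t` that has to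
be interchanged, and one factor `-1` for every square `e_s e_s = -1`. -/
def sgn {m : ℕ} (S T : Finset (Fin m)) : ℤ :=
  ∏ s ∈ S, ∏ t ∈ T, if t ≤ s then -1 else 1

/-- The basis element `e_T`. -/
def eT {m : ℕ} (T : Finset (Fin m)) : Cl m := EuclideanSpace.single T 1

/-- The generator `e_j`. -/
def e {m : ℕ} (j : Fin m) : Cl m := eT {j}

/-- The product of `∑ x_S e_S` and `∑ y_T e_T`: the coefficient of `e_U` collects the pairs with
`S ∆ T = U`, that is `T = S ∆ U`. -/
instance instMulCl (m : ℕ) : Mul (Cl m) :=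
  ⟨fun x y => WithLp.toLp 2 fun U => ∑ S, (sgn S (S ∆ U) : ℂ) * (x S * y (S ∆ U))⟩

instance instOneCl (m : ℕ) : One (Cl m) := ⟨eT ∅⟩

theorem mul_apply {m : ℕ} (x y : Cl m) (U : Finset (Fin m)) :
    (x * y) U = ∑ S, (sgn S (S ∆ U) : ℂ) * (x S * y (S ∆ U)) := rfl

theorem one_def (m : ℕ) : (1 : Cl m) = eT ∅ := rfl

theorem eT_apply {m : ℕ} (T U : Finset (Fin m)) :
    (eT T : Cl m) U = if U = T then 1 else 0 := by
  simp [eT]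

theorem prod_symmDiff {m : ℕ} (f : Fin m → ℤ) (hf : ∀ i, f i * f i = 1) (S T : Finset (Fin m)) :
    ∏ i ∈ S ∆ T, f i = (∏ i ∈ S, f i) * ∏ i ∈ T, f i := by
  have hind : ∀ A : Finset (Fin m), ∏ i ∈ A, f i = ∏ i, if i ∈ A then f i else 1 := by
    intro A; simp
  rw [hind, hind S, hind T, ← Finset.prod_mul_distrib]
  refine Finset.prod_congr rfl fun i _ => ?_
  by_cases h1 : i ∈ S <;> by_cases h2 : i ∈ T <;> simp [Finset.mem_symmDiff, h1, h2, hf]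

theorem sgn_symmDiff_left {m : ℕ} (S T U : Finset (Fin m)) :
    sgn (S ∆ T) U = sgn S U * sgn T U := by
  unfold sgn
  refine prod_symmDiff _ (fun i => ?_) S T
  rw [← Finset.prod_mul_distrib]
  exact Finset.prod_eq_one fun j _ => by split_ifs <;> simp

theorem sgn_symmDiff_right {m : ℕ} (S T U : Finset (Fin m)) :
    sgn S (T ∆ U) = sgn S T * sgn S U := by
  unfold sgn
  rw [← Finset.prod_mul_distrib]
  exact Finset.prod_congr rfl fun s _ => prod_symmDiff _ (fun j => by split_ifs <;> simp) T U

theorem sgn_empty_left {m : ℕ} (T : Finset (Fin m)) : sgn ∅ T = 1 := by simp [sgn]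

theorem sgn_empty_right {m : ℕ} (T : Finset (Fin m)) : sgn T ∅ = 1 := by simp [sgn]

theorem cl_mul_assoc {m : ℕ} (x y z : Cl m) : x * y * z = x * (y * z) := by
  ext U
  simp only [mul_apply, Finset.mul_sum, Finset.sum_mul]
  rw [Finset.sum_comm]
  refine Finset.sum_congr rfl fun S _ => ?_
  refine Fintype.sum_equiv (Equiv.mk (fun V => S ∆ V) (fun V => S ∆ V)
    (fun V => by simp) (fun V => by simp)) _ _ fun V => ?_
  have h1 : (S ∆ V) ∆ (S ∆ U) = V ∆ U := by
    rw [symmDiff_symmDiff_symmDiff_comm, symmDiff_self, bot_symmDiff]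
  have h2 : sgn V (V ∆ U) = sgn S (V ∆ U) * sgn (S ∆ V) (V ∆ U) := by
    conv_lhs => rw [← symmDiff_symmDiff_cancel_left S V]
    rw [sgn_symmDiff_left, symmDiff_symmDiff_cancel_left]
  have h3 : sgn S (S ∆ U) = sgn S (S ∆ V) * sgn S (V ∆ U) := by
    rw [← sgn_symmDiff_right]; congr 1
    rw [symmDiff_assoc, symmDiff_symmDiff_cancel_left]
  simp only [Equiv.coe_fn_mk, h1, h2, h3]
  push_cast
  ring

instance instRingCl (m : ℕ) : Ring (Cl m) :=
  { (inferInstance : AddCommGroup (Cl m)), instMulCl m, instOneCl m with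
    left_distrib := fun x y z => by
      ext U
      change (x * (y + z)) U = (x * y) U + (x * z) U
      simp only [mul_apply, PiLp.add_apply, ← Finset.sum_add_distrib]
      exact Finset.sum_congr rfl fun _ _ => by ring
    right_distrib := fun x y z => by
      ext U
      change ((x + y) * z) U = (x * z) U + (y * z) U
      simp only [mul_apply, PiLp.add_apply, ← Finset.sum_add_distrib]
      exact Finset.sum_congr rfl fun _ _ => by ring
    zero_mul := fun x => by
      ext U
      change ((0 : Cl m) * x) U = 0
      simp [mul_apply]
    mul_zero := fun x => by
      ext U
      change (x * (0 : Cl m)) U = 0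
      simp [mul_apply]
    mul_assoc := cl_mul_assoc
    one_mul := fun x => by
      ext U
      change ((1 : Cl m) * x) U = x U
      have h : (∅ : Finset (Fin m)) ∆ U = U := bot_symmDiff U
      simp [mul_apply, one_def, eT_apply, h, sgn_empty_left]
    mul_one := fun x => by
      ext U
      change (x * (1 : Cl m)) U = x U
      rw [mul_apply, Finset.sum_eq_single U]
      · simp [one_def, eT_apply, sgn_empty_right]
      · intro S _ hS
        have : S ∆ U ≠ ∅ := fun h => hS (symmDiff_eq_bot.1 h)
        simp [one_def, eT_apply, this]
      · simp }

instance instAlgebraCl (m : ℕ) : Algebra ℂ (Cl m) :=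
  Algebra.ofModule
    (fun r x y => by
      ext U
      simp only [mul_apply, PiLp.smul_apply, smul_eq_mul, Finset.mul_sum]
      exact Finset.sum_congr rfl fun _ _ => by ring)
    (fun r x y => by
      ext U
      simp only [mul_apply, PiLp.smul_apply, smul_eq_mul, Finset.mul_sum]
      exact Finset.sum_congr rfl fun _ _ => by ring)

theorem eT_mul_eT {m : ℕ} (S T : Finset (Fin m)) :
    (eT S * eT T : Cl m) = (sgn S T : ℂ) • eT (S ∆ T) := by
  ext U
  rw [mul_apply, Finset.sum_eq_single S]
  · by_cases h : U = S ∆ T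
    · subst h; simp [eT_apply]
    · have : S ∆ U ≠ T := fun h' => h (by rw [← h', symmDiff_symmDiff_cancel_left])
      simp [eT_apply, h, this]
  · intro V _ hV
    simp [eT_apply, hV]
  · simp

/-- The defining relations of the Clifford algebra. -/
theorem e_mul_e_add {m : ℕ} (j k : Fin m) :
    (e j * e k + e k * e j : Cl m) = if j = k then -2 else 0 := by
  unfold e
  rw [eT_mul_eT, eT_mul_eT]
  by_cases h : j = k
  · subst h
    simp [sgn, ← one_def]
    norm_num
  · rw [symmDiff_comm ({k} : Finset (Fin m)) {j}, if_neg h]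
    rcases lt_or_gt_of_ne h with h' | h'
    · simp [sgn, h'.le, h'.not_ge]
    · simp [sgn, h'.le, h'.not_ge]

/-- `e_T` is the product of its generators in increasing order. -/
theorem e_mul_eT {m : ℕ} (j : Fin m) (T : Finset (Fin m)) (h : ∀ t ∈ T, j < t) :
    (e j * eT T : Cl m) = eT (insert j T) := by
  have hj : j ∉ T := fun h' => lt_irrefl _ (h j h')
  have h1 : sgn {j} T = 1 := by
    simp only [sgn, Finset.prod_singleton]
    exact Finset.prod_eq_one fun t ht => if_neg (h t ht).not_ge
  have h2 : ({j} : Finset (Fin m)) ∆ T = insert j T := by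
    ext i
    simp only [Finset.mem_symmDiff, Finset.mem_singleton, Finset.mem_insert]
    by_cases hi : i = j
    · subst hi; simp [hj]
    · simp [hi]
  rw [e, eT_mul_eT, h1, h2]; simp

/-- Clifford conjugation `x̄ = ∑_T conj(x_T) ē_T`. Here `ē_T` is the product of the `ē_j = -e_j`,
`j ∈ T`, in decreasing order, that is `ē_T = (-1)^{|T|(|T|+1)/2} e_T`. -/
def conj {m : ℕ} (x : Cl m) : Cl m :=
  WithLp.toLp 2 fun T => (-1 : ℂ) ^ (T.card * (T.card + 1) / 2) * starRingEnd ℂ (x T)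

theorem sgn_self {m : ℕ} (T : Finset (Fin m)) :
    sgn T T = (-1) ^ (T.card * (T.card + 1) / 2) := by
  induction T using Finset.induction_on_max with
  | empty => simp [sgn]
  | insert i T hi ih =>
    have hn : i ∉ T := fun h => lt_irrefl _ (hi i h)
    have h1 : ∀ A : Finset (Fin m), sgn (insert i T) A = sgn {i} A * sgn T A := fun A => by
      simp [sgn, Finset.prod_insert hn]
    have h2 : sgn {i} (insert i T) = -(-1) ^ T.card := by
      rw [sgn, Finset.prod_singleton, Finset.prod_insert hn, if_pos le_rfl,
        Finset.prod_congr rfl fun t ht => if_pos (hi t ht).le]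
      simp
    have h3 : sgn T (insert i T) = sgn T T := by
      unfold sgn
      refine Finset.prod_congr rfl fun s hs => ?_
      rw [Finset.prod_insert hn, if_neg (hi s hs).not_ge, one_mul]
    have h4 : (T.card + 1) * (T.card + 1 + 1) / 2 = T.card * (T.card + 1) / 2 + (T.card + 1) := by
      rw [← Nat.add_mul_div_right _ _ (by norm_num : 0 < 2)]; congr 1; ring
    rw [h1, h2, h3, ih, Finset.card_insert_of_notMem hn, h4, pow_add, pow_succ (-1) T.card]
    ring

theorem conj_e {m : ℕ} (j : Fin m) : conj (e j : Cl m) = -e j := by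
  ext T
  by_cases h : T = {j}
  · subst h; simp [conj, e, eT_apply]
  · simp [conj, e, eT_apply, h]

theorem conj_mul {m : ℕ} (x y : Cl m) : conj (x * y) = conj y * conj x := by
  have hsq : ∀ S T : Finset (Fin m), sgn S T * sgn S T = 1 := fun S T => by
    rw [← sgn_symmDiff_left, symmDiff_self]; exact sgn_empty_left T
  have hc : ∀ (z : Cl m) T, conj z T = (sgn T T : ℂ) * starRingEnd ℂ (z T) := fun z T => by
    simp [conj, sgn_self]
  ext U
  rw [hc, mul_apply, mul_apply, map_sum, Finset.mul_sum]
  refine Fintype.sum_equiv (Equiv.mk (fun V => V ∆ U) (fun V => V ∆ U)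
    (fun V => by simp) (fun V => by simp)) _ _ fun S => ?_
  obtain ⟨T, rfl⟩ : ∃ T, U = S ∆ T := ⟨S ∆ U, by simp⟩
  have h1 : S ∆ (S ∆ T) = T := symmDiff_symmDiff_cancel_left S T
  have h2 : T ∆ (S ∆ T) = S := by rw [symmDiff_comm S T, symmDiff_symmDiff_cancel_left]
  have h3 : sgn (S ∆ T) (S ∆ T) * sgn S T = sgn T S * sgn T T * sgn S S := by
    simp only [sgn_symmDiff_left, sgn_symmDiff_right]
    linear_combination (sgn S S * sgn T S * sgn T T) * hsq S T
  have h4 : ((sgn (S ∆ T) (S ∆ T) : ℤ) : ℂ) * (sgn S T : ℂ) =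
      (sgn T S : ℂ) * (sgn T T : ℂ) * (sgn S S : ℂ) := by exact_mod_cast h3
  simp only [Equiv.coe_fn_mk, h1, h2, hc, map_mul, map_intCast]
  linear_combination (starRingEnd ℂ (x S) * starRingEnd ℂ (y T)) * h4

/-- The space `ℝ^{m+1}` of para-vectors `x = x_0 + x̲`, with `x.1 = x_0 ∈ ℝ` and
`x.2 = x̲ ∈ ℝ^m`. Only its topology, its linear structure and its Lebesgue measure are used. -/
abbrev Para (m : ℕ) : Type := ℝ × EuclideanSpace ℝ (Fin m)

/-- The strip `S_a = {x : |x_0| < a}`. -/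
def strip (m : ℕ) (a : ℝ) : Set (Para m) := {x | |x.1| < a}

/-- The Dirac operator `D F = ∑_{k=0}^m e_k ∂_k F`, where `e_0 = 1`. -/
def dirac {m : ℕ} (F : Para m → Cl m) (x : Para m) : Cl m :=
  fderiv ℝ F x (1, 0) + ∑ j : Fin m, e j * fderiv ℝ F x (0, EuclideanSpace.single j 1)

/-- `F` is left-monogenic in the open set `Ω`: it is continuously differentiable there and
`D F = 0`. -/
def LeftMonogenicOn {m : ℕ} (F : Para m → Cl m) (Ω : Set (Para m)) : Prop :=
  ContDiffOn ℝ 1 F Ω ∧ ∀ x ∈ Ω, dirac F x = 0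

/-- Membership in the Bergman space `A²(S_a, ℂ^(m))`: left-monogenic in `S_a` and square
integrable over `S_a`. -/
def MemA2 {m : ℕ} (a : ℝ) (f : Para m → Cl m) : Prop :=
  LeftMonogenicOn f (strip m a) ∧
    MeasureTheory.MemLp f 2 (MeasureTheory.volume.restrict (strip m a))

/-- `B` is the Bergman kernel, that is the reproducing kernel of `A²(S_a, ℂ^(m))` for the inner
product `⟨f, g⟩ = ∫_{S_a} ḡ f`. The value `B w x` stands for `B(w, x̄)`; only its values for
`w, x ∈ S_a` matter. -/
structure IsBergmanKernel (m : ℕ) (a : ℝ) (B : Para m → Para m → Cl m) : Prop where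
  mem : ∀ x ∈ strip m a, MemA2 a fun w => B w x
  reproducing : ∀ f : Para m → Cl m, MemA2 a f → ∀ x ∈ strip m a,
    f x = ∫ w in strip m a, conj (B w x) * f w

end StripBergman

end

noncomputable section

namespace StripBergman

/-! ### Clifford arithmetic of para-vectors -/

section Algebra

variable {m : ℕ}

/-! The kernel is written down by the method of images. Let E(v) = v̄ / |v|^(m+1) be the
unnormalised Cauchy kernel (`cauchyReg 0`) and σ its normalising constant. The candidate
`stripKernel` is -(2/σ) ∑_n ∂_0 E(w + x̄ + 2a(2n+1)), n ∈ ℤ. Its poles are the reflections of x in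
the two boundary planes and the translates of these by multiples of 4a, all outside the strip. Each
term decays like the power -(m+1) of the distance to its pole, so the series converges, may be
differentiated termwise, and lies in A².

For the reproducing property let χ be a compactly supported cutoff. Since E is monogenic, the right
Dirac operator maps Ē to 2 conj(∂_0 E) (`rightD_cauchyConj`), so Green's formula turns ∫ χ conj(B) f
into an integral against ∇χ. The Cauchy–Pompeiu formula (`sigma_smul_eq_integral`) does the same for
χ(x) f(x), and the translates E(w - x + 4an), n ≠ 0, may be added because they contribute zero. As
Ē(t, y) = -E(-t, y), the combined kernel multiplying ∇χ is a sum of differences of E that vanish on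
the planes w_0 = ±a. It is therefore O(a - |w_0|) with square integrable decay, up to an end term
that tends to zero (`exists_norm_reflSum_le`). The cutoffs have (a - |w_0|)|∇χ| bounded, so f ∈ L²
gives a dominating function and the error tends to zero (`stripKernel_reproducing`). No boundary
values of f are needed.

A reproducing kernel is unique (`IsBergmanKernel.unique`), so the estimates need only be read off
the series. On the diagonal every term is a positive scalar after normalisation. The nearest image,
at distance 2(a - |x_0|), gives the lower bound, and comparison with ∑ (1 + |n|)^(-2) gives the
upper one (`stripKernel_self`). For |w̲ - x̲| ≥ 1 the series is bounded by a multiple of |w̲ -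
x̲|^(-(m-1)/2) uniformly up to the boundary. The factor 2a - |w_0 + x_0| lies in (0, 2a], so any
nonnegative power of it can be put in the denominator at the cost of a constant
(`norm_stripKernel_le_rpow`). Both parities follow in the same way. -/

instance instIsScalarTowerReal : IsScalarTower ℝ (Cl m) (Cl m) :=
  ⟨fun r x y => by
    ext U
    simp only [smul_eq_mul, mul_apply, PiLp.smul_apply, Complex.real_smul, Finset.mul_sum]
    exact Finset.sum_congr rfl fun _ _ => by ring⟩

instance instSMulCommClassReal : SMulCommClass ℝ (Cl m) (Cl m) :=
  ⟨fun r x y => by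
    ext U
    simp only [smul_eq_mul, mul_apply, PiLp.smul_apply, Complex.real_smul, Finset.mul_sum]
    exact Finset.sum_congr rfl fun _ _ => by ring⟩

/-- Clifford multiplication as a continuous real-bilinear map. -/
def mulL (m : ℕ) : Cl m →L[ℝ] Cl m →L[ℝ] Cl m :=
  LinearMap.toContinuousLinearMap
    ((LinearMap.toContinuousLinearMap : (Cl m →ₗ[ℝ] Cl m) ≃ₗ[ℝ] _).toLinearMap ∘ₗ
      (LinearMap.mk₂ ℝ (fun x y : Cl m => x * y) add_mul smul_mul_assoc mul_add
        fun c x y => mul_smul_comm c x y))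

@[simp] theorem mulL_apply (x y : Cl m) : mulL m x y = x * y := rfl

theorem norm_mul_le_mulL (x y : Cl m) : ‖x * y‖ ≤ ‖mulL m‖ * ‖x‖ * ‖y‖ :=
  (mulL m).le_opNorm₂ x y

/-- Clifford conjugation as a continuous real-linear equivalence. -/
def conjL (m : ℕ) : Cl m ≃L[ℝ] Cl m :=
  LinearEquiv.toContinuousLinearEquiv
    { toFun := conj
      invFun := conj
      map_add' := fun x y => by ext T; simp [conj, mul_add]
      map_smul' := fun r x => by ext T; simp [conj]; ring
      left_inv := fun x => by
        ext T; simp only [conj, map_mul, map_pow, map_neg, map_one, starRingEnd_self_apply]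
        rw [← mul_assoc, ← mul_pow]; simp
      right_inv := fun x => by
        ext T; simp only [conj, map_mul, map_pow, map_neg, map_one, starRingEnd_self_apply]
        rw [← mul_assoc, ← mul_pow]; simp }

@[simp] theorem conjL_apply (x : Cl m) : conjL m x = conj x := rfl

theorem conj_conj (x : Cl m) : conj (conj x) = x := (conjL m).left_inv x

theorem conj_one : conj (1 : Cl m) = 1 := by
  ext T
  by_cases h : T = ∅
  · subst h; simp [conj, one_def, eT_apply]
  · simp [conj, one_def, eT_apply, h]

theorem norm_conj (x : Cl m) : ‖conj x‖ = ‖x‖ := by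
  simp [EuclideanSpace.norm_eq, conj]

theorem norm_eT (T : Finset (Fin m)) : ‖(eT T : Cl m)‖ = 1 := by
  simp [eT]

theorem norm_e (j : Fin m) : ‖(e j : Cl m)‖ = 1 := norm_eT _

theorem norm_one_cl : ‖(1 : Cl m)‖ = 1 := norm_eT _

theorem e_mul_self (j : Fin m) : (e j * e j : Cl m) = -1 := by
  have h := e_mul_e_add j j
  rw [if_pos rfl, ← two_smul ℝ] at h
  have h2 : (2 : ℝ) • (e j * e j : Cl m) = (2 : ℝ) • (-1) := by
    rw [h, two_smul]; norm_num
  exact smul_right_injective _ (two_ne_zero) h2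

/-- The embedding of the vectors `x̲ ∈ ℝ^m` into the Clifford algebra. -/
def vecL (m : ℕ) : EuclideanSpace ℝ (Fin m) →L[ℝ] Cl m :=
  LinearMap.toContinuousLinearMap
    { toFun := fun y => ∑ j, y j • (e j : Cl m)
      map_add' := fun x y => by simp [add_smul, Finset.sum_add_distrib]
      map_smul' := fun r x => by simp [Finset.smul_sum, mul_smul] }

theorem vecL_apply (y : EuclideanSpace ℝ (Fin m)) : vecL m y = ∑ j, y j • (e j : Cl m) := rfl

/-- The embedding of the para-vectors into the Clifford algebra. -/
def paraL (m : ℕ) : Para m →L[ℝ] Cl m :=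
  (ContinuousLinearMap.fst ℝ _ _).smulRight (1 : Cl m) + (vecL m).comp (ContinuousLinearMap.snd ℝ _ _)

theorem paraL_apply (u : Para m) : paraL m u = u.1 • (1 : Cl m) + vecL m u.2 := rfl

/-- The conjugation of para-vectors. -/
def bar (m : ℕ) : Para m →L[ℝ] Para m :=
  (ContinuousLinearMap.fst ℝ _ _).prod (-ContinuousLinearMap.snd ℝ _ _)

theorem bar_apply (u : Para m) : bar m u = (u.1, -u.2) := rfl

theorem paraL_bar (u : Para m) : paraL m (bar m u) = u.1 • (1 : Cl m) - vecL m u.2 := by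
  simp [paraL_apply, bar_apply, sub_eq_add_neg]

/-- The squared Euclidean norm of a para-vector. -/
def sqn (u : Para m) : ℝ := u.1 ^ 2 + ‖u.2‖ ^ 2

theorem sqn_nonneg (u : Para m) : 0 ≤ sqn u := by unfold sqn; positivity

theorem sqn_bar (u : Para m) : sqn (bar m u) = sqn u := by simp [sqn, bar_apply]

/-- Adding the double sum to itself with the indices exchanged leaves only the anticommutators,
hence only the diagonal. -/
theorem vecL_mul_vecL (y : EuclideanSpace ℝ (Fin m)) :
    vecL m y * vecL m y = -(‖y‖ ^ 2) • (1 : Cl m) := by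
  have h1 : vecL m y * vecL m y = ∑ i, ∑ j, (y i * y j) • (e i * e j : Cl m) := by
    rw [vecL_apply, Finset.sum_mul_sum]
    refine Finset.sum_congr rfl fun i _ => Finset.sum_congr rfl fun j _ => ?_
    rw [smul_mul_smul_comm]
  have h2 : vecL m y * vecL m y = ∑ i, ∑ j, (y i * y j) • (e j * e i : Cl m) := by
    rw [h1, Finset.sum_comm]
    refine Finset.sum_congr rfl fun i _ => Finset.sum_congr rfl fun j _ => ?_
    rw [mul_comm]
  have h3 : (2 : ℝ) • (vecL m y * vecL m y) = (2 : ℝ) • (-(‖y‖ ^ 2) • (1 : Cl m)) := by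
    rw [two_smul]
    nth_rewrite 1 [h1]
    rw [h2, ← Finset.sum_add_distrib]
    simp_rw [← Finset.sum_add_distrib, ← smul_add, e_mul_e_add]
    simp only [smul_ite, smul_zero, Finset.sum_ite_eq, Finset.mem_univ, if_true]
    rw [← Finset.sum_smul, EuclideanSpace.real_norm_sq_eq]
    have : (-2 : Cl m) = (-2 : ℝ) • 1 := by
      rw [neg_smul, two_smul]; norm_num
    rw [this, smul_smul, smul_smul]
    congr 1
    simp only [sq]; ring
  exact smul_right_injective _ (two_ne_zero) h3

theorem paraL_bar_mul (u : Para m) : paraL m (bar m u) * paraL m u = sqn u • (1 : Cl m) := by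
  rw [paraL_bar, paraL_apply, sub_mul, mul_add, mul_add, vecL_mul_vecL]
  simp only [smul_mul_assoc, mul_smul_comm, one_mul, mul_one, sqn, smul_smul]
  module

theorem paraL_mul_bar (u : Para m) : paraL m u * paraL m (bar m u) = sqn u • (1 : Cl m) := by
  rw [paraL_bar, paraL_apply, add_mul, mul_sub, mul_sub, vecL_mul_vecL]
  simp only [smul_mul_assoc, mul_smul_comm, one_mul, mul_one, sqn, smul_smul]
  module

theorem paraL_mul_self (u : Para m) :
    paraL m u * paraL m u = (2 * u.1) • paraL m u - sqn u • (1 : Cl m) := by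
  rw [paraL_apply, add_mul, mul_add, mul_add, vecL_mul_vecL]
  simp only [smul_mul_assoc, mul_smul_comm, one_mul, mul_one, sqn, smul_smul]
  module

theorem paraL_add_bar (u : Para m) : paraL m u + paraL m (bar m u) = (2 * u.1) • (1 : Cl m) := by
  rw [paraL_bar, paraL_apply]; module

theorem conj_paraL (u : Para m) : conj (paraL m u) = paraL m (bar m u) := by
  rw [paraL_bar, paraL_apply, ← conjL_apply, map_add, map_smul, vecL_apply, map_sum]
  simp [conj_one, conj_e, sub_eq_add_neg]

theorem norm_paraL_le (u : Para m) : ‖paraL m u‖ ≤ (m + 1) * √(sqn u) := by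
  have h0 : |u.1| ≤ √(sqn u) := Real.abs_le_sqrt (by unfold sqn; nlinarith [sq_nonneg ‖u.2‖])
  have h1 : ‖u.2‖ ≤ √(sqn u) :=
    Real.le_sqrt_of_sq_le (by unfold sqn; nlinarith [sq_nonneg u.1])
  have h2 : ‖vecL m u.2‖ ≤ m * √(sqn u) := by
    rw [vecL_apply]
    refine (norm_sum_le_of_le _ (f := fun j => u.2 j • (e j : Cl m))
      (n := fun _ => √(sqn u)) fun j _ => ?_).trans (by simp)
    rw [norm_smul, norm_e, mul_one]
    exact (PiLp.norm_apply_le u.2 j).trans h1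
  rw [paraL_apply]
  refine (norm_add_le _ _).trans ?_
  rw [norm_smul, norm_one_cl, Real.norm_eq_abs]
  linarith

theorem norm_paraL_bar_le (u : Para m) : ‖paraL m (bar m u)‖ ≤ (m + 1) * √(sqn u) := by
  simpa [sqn_bar] using norm_paraL_le (bar m u)

end Algebra

/-! ### The Cauchy kernel, its derivatives and their size -/

section Calculus

variable {m : ℕ}

/-- The `j`-th basis vector of `ℝ^m` as a para-vector. -/
def basisVec (j : Fin m) : Para m := (0, EuclideanSpace.single j 1)

/-- The symbol of the Dirac operator acting from the left. -/
def leftD (m : ℕ) : (Para m →L[ℝ] Cl m) →L[ℝ] Cl m :=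
  ContinuousLinearMap.apply ℝ _ ((1, 0) : Para m) +
    ∑ j : Fin m, (mulL m (e j)).comp (ContinuousLinearMap.apply ℝ _ (basisVec j))

/-- The symbol of the Dirac operator acting from the right. -/
def rightD (m : ℕ) : (Para m →L[ℝ] Cl m) →L[ℝ] Cl m :=
  ContinuousLinearMap.apply ℝ _ ((1, 0) : Para m) +
    ∑ j : Fin m, ((mulL m).flip (e j)).comp (ContinuousLinearMap.apply ℝ _ (basisVec j))

/-- The gradient of a scalar function, as a Clifford number. -/
def gradD (m : ℕ) : (Para m →L[ℝ] ℝ) →L[ℝ] Cl m :=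
  (ContinuousLinearMap.apply ℝ _ ((1, 0) : Para m)).smulRight 1 +
    ∑ j : Fin m, (ContinuousLinearMap.apply ℝ _ (basisVec j)).smulRight (e j)

theorem leftD_apply (T : Para m →L[ℝ] Cl m) :
    leftD m T = T (1, 0) + ∑ j, e j * T (basisVec j) := by
  simp [leftD]

theorem rightD_apply (T : Para m →L[ℝ] Cl m) :
    rightD m T = T (1, 0) + ∑ j, T (basisVec j) * e j := by
  simp [rightD]

theorem gradD_apply (l : Para m →L[ℝ] ℝ) :
    gradD m l = l (1, 0) • (1 : Cl m) + ∑ j, l (basisVec j) • (e j : Cl m) := by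
  simp [gradD]

theorem dirac_eq_leftD (F : Para m → Cl m) (x : Para m) : dirac F x = leftD m (fderiv ℝ F x) := by
  rw [leftD_apply]; rfl

theorem leftD_smulRight (l : Para m →L[ℝ] ℝ) (c : Cl m) :
    leftD m (l.smulRight c) = gradD m l * c := by
  simp [leftD_apply, gradD_apply, add_mul, Finset.sum_mul]

theorem rightD_smulRight (l : Para m →L[ℝ] ℝ) (c : Cl m) :
    rightD m (l.smulRight c) = c * gradD m l := by
  simp [rightD_apply, gradD_apply, mul_add, Finset.mul_sum]

theorem vecL_single (j : Fin m) : vecL m (EuclideanSpace.single j 1) = e j := by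
  rw [vecL_apply, Finset.sum_eq_single j] <;> simp +contextual

theorem paraL_one_zero : paraL m (1, 0) = 1 := by simp [paraL_apply]

theorem paraL_basisVec (j : Fin m) : paraL m (basisVec j) = e j := by
  simp [paraL_apply, basisVec, vecL_single]

theorem rightD_paraL : rightD m (paraL m) = (1 - m : ℝ) • (1 : Cl m) := by
  rw [rightD_apply, paraL_one_zero]
  simp_rw [paraL_basisVec, e_mul_self]
  rw [Finset.sum_const, Finset.card_univ, Fintype.card_fin, ← Nat.cast_smul_eq_nsmul ℝ]
  module

theorem rightD_paraL_bar :
    rightD m ((paraL m).comp (bar m)) = (1 + m : ℝ) • (1 : Cl m) := by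
  have h : ∀ j : Fin m, paraL m (bar m (basisVec j)) * e j = 1 := fun j => by
    simp [paraL_bar, basisVec, vecL_single, e_mul_self]
  rw [rightD_apply]
  simp only [ContinuousLinearMap.comp_apply, h]
  rw [Finset.sum_const, Finset.card_univ, Fintype.card_fin, ← Nat.cast_smul_eq_nsmul ℝ, paraL_bar]
  simp
  module

theorem leftD_paraL_bar :
    leftD m ((paraL m).comp (bar m)) = (1 + m : ℝ) • (1 : Cl m) := by
  have h : ∀ j : Fin m, e j * paraL m (bar m (basisVec j)) = 1 := fun j => by
    simp [paraL_bar, basisVec, vecL_single, e_mul_self]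
  rw [leftD_apply]
  simp only [ContinuousLinearMap.comp_apply, h]
  rw [Finset.sum_const, Finset.card_univ, Fintype.card_fin, ← Nat.cast_smul_eq_nsmul ℝ, paraL_bar]
  simp
  module

/-- The Euclidean inner product with a para-vector. -/
def dotL (v : Para m) : Para m →L[ℝ] ℝ :=
  v.1 • ContinuousLinearMap.fst ℝ _ _ + (innerSL ℝ v.2).comp (ContinuousLinearMap.snd ℝ _ _)

theorem dotL_apply (v h : Para m) : dotL v h = v.1 * h.1 + inner ℝ v.2 h.2 := rfl

theorem gradD_dotL (v : Para m) : gradD m (dotL v) = paraL m v := by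
  simp [gradD_apply, dotL_apply, basisVec, paraL_apply, vecL_apply, EuclideanSpace.inner_single_right]

theorem gradD_fst : gradD m (ContinuousLinearMap.fst ℝ _ _) = 1 := by
  simp [gradD_apply, basisVec]

theorem abs_fst_le_sqrt_sqn (u : Para m) : |u.1| ≤ √(sqn u) :=
  Real.abs_le_sqrt (by unfold sqn; nlinarith [sq_nonneg ‖u.2‖])

theorem norm_snd_le_sqrt_sqn (u : Para m) : ‖u.2‖ ≤ √(sqn u) :=
  Real.le_sqrt_of_sq_le (by unfold sqn; nlinarith [sq_nonneg u.1])

theorem norm_dotL_le (v : Para m) : ‖dotL v‖ ≤ 2 * √(sqn v) := by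
  refine ContinuousLinearMap.opNorm_le_bound _ (by positivity) fun h => ?_
  rw [dotL_apply]
  have h1 : ‖v.1 * h.1‖ ≤ √(sqn v) * ‖h‖ := by
    rw [norm_mul]
    exact mul_le_mul (abs_fst_le_sqrt_sqn v) (norm_fst_le h) (norm_nonneg _) (Real.sqrt_nonneg _)
  have h2 : ‖inner ℝ v.2 h.2‖ ≤ √(sqn v) * ‖h‖ :=
    (norm_inner_le_norm _ _).trans
      (mul_le_mul (norm_snd_le_sqrt_sqn v) (norm_snd_le h) (norm_nonneg _) (Real.sqrt_nonneg _))
  linarith [norm_add_le (v.1 * h.1) (inner ℝ v.2 h.2)]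

theorem hasFDerivAt_sqn (v : Para m) : HasFDerivAt (sqn : Para m → ℝ) ((2 : ℝ) • dotL v) v := by
  have h1 : HasFDerivAt (fun u : Para m => u.1 ^ 2) _ v := (hasFDerivAt_fst (𝕜 := ℝ) (p := v)).pow 2
  have h2 : HasFDerivAt (fun u : Para m => ‖u.2‖ ^ 2) _ v :=
    (hasFDerivAt_snd (𝕜 := ℝ) (p := v)).norm_sq
  refine (h1.add h2).congr_fderiv ?_
  ext h <;> simp [dotL_apply]

theorem contDiff_sqn {n : WithTop ℕ∞} : ContDiff ℝ n (sqn : Para m → ℝ) :=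
  (contDiff_fst.pow 2).add (contDiff_snd.norm_sq ℝ)

theorem hasFDerivAt_sqn_rpow (β ε : ℝ) (v : Para m) (hv : 0 < sqn v + ε) :
    HasFDerivAt (fun u : Para m => (sqn u + ε) ^ (-β))
      ((-(2 * β) * (sqn v + ε) ^ (-β - 1)) • dotL v) v := by
  refine (((hasFDerivAt_sqn v).add_const ε).rpow_const (Or.inl hv.ne')).congr_fderiv ?_
  rw [smul_smul]; congr 1; ring

theorem contDiffAt_sqn_rpow {n : WithTop ℕ∞} (β ε : ℝ) (v : Para m) (hv : 0 < sqn v + ε) :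
    ContDiffAt ℝ n (fun u : Para m => (sqn u + ε) ^ (-β)) v :=
  (contDiff_sqn.contDiffAt.add contDiffAt_const).rpow_const_of_ne hv.ne'

/-- The exponent `(m + 1) / 2`. -/
abbrev hexp (m : ℕ) : ℝ := ((m : ℝ) + 1) / 2

/-- The regularised Cauchy kernel `v̄ (|v|² + ε)^{-(m+1)/2}`; the Cauchy kernel for `ε = 0`. -/
def cauchyReg (ε : ℝ) (v : Para m) : Cl m := (sqn v + ε) ^ (-hexp m) • paraL m (bar m v)

/-- The conjugate Cauchy kernel `v |v|^{-(m+1)}`. -/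
def cauchyConj (v : Para m) : Cl m := (sqn v + 0) ^ (-hexp m) • paraL m v

/-- The derivative `∂_0` of the Cauchy kernel. -/
def cauchyDer (v : Para m) : Cl m :=
  (sqn v + 0) ^ (-hexp m) • (1 : Cl m) -
    ((m + 1) * (v.1 * (sqn v + 0) ^ (-(hexp m + 1)))) • paraL m (bar m v)

theorem bar_bar (u : Para m) : bar m (bar m u) = u := by simp [bar_apply]

theorem conj_cauchyDer (v : Para m) :
    conj (cauchyDer v) = (sqn v + 0) ^ (-hexp m) • (1 : Cl m) -
      ((m + 1) * (v.1 * (sqn v + 0) ^ (-(hexp m + 1)))) • paraL m v := by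
  rw [cauchyDer, ← conjL_apply, map_sub, map_smul, map_smul, conjL_apply, conjL_apply, conj_one,
    conj_paraL, bar_bar]

theorem hasFDerivAt_cauchyReg (ε : ℝ) (v : Para m) (hv : 0 < sqn v + ε) :
    HasFDerivAt (cauchyReg ε : Para m → Cl m)
      ((sqn v + ε) ^ (-hexp m) • (paraL m).comp (bar m) +
        ((-(2 * hexp m) * (sqn v + ε) ^ (-hexp m - 1)) • dotL v).smulRight (paraL m (bar m v))) v :=
  (hasFDerivAt_sqn_rpow _ ε v hv).smul ((paraL m).comp (bar m)).hasFDerivAt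

theorem hasFDerivAt_cauchyConj (v : Para m) (hv : 0 < sqn v + 0) :
    HasFDerivAt (cauchyConj : Para m → Cl m)
      ((sqn v + 0) ^ (-hexp m) • paraL m +
        ((-(2 * hexp m) * (sqn v + 0) ^ (-hexp m - 1)) • dotL v).smulRight (paraL m v)) v :=
  (hasFDerivAt_sqn_rpow _ 0 v hv).smul (paraL m).hasFDerivAt

theorem contDiffAt_cauchyReg {n : WithTop ℕ∞} (ε : ℝ) (v : Para m) (hv : 0 < sqn v + ε) :
    ContDiffAt ℝ n (cauchyReg ε : Para m → Cl m) v :=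
  (contDiffAt_sqn_rpow _ ε v hv).smul ((paraL m).comp (bar m)).contDiff.contDiffAt

theorem contDiffAt_cauchyConj {n : WithTop ℕ∞} (v : Para m) (hv : 0 < sqn v + 0) :
    ContDiffAt ℝ n (cauchyConj : Para m → Cl m) v :=
  (contDiffAt_sqn_rpow _ 0 v hv).smul (paraL m).contDiff.contDiffAt

theorem contDiffAt_cauchyDer {n : WithTop ℕ∞} (v : Para m) (hv : 0 < sqn v + 0) :
    ContDiffAt ℝ n (cauchyDer : Para m → Cl m) v :=
  ((contDiffAt_sqn_rpow _ 0 v hv).smul contDiffAt_const).sub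
    ((contDiffAt_const.mul (contDiffAt_fst.mul (contDiffAt_sqn_rpow _ 0 v hv))).smul
      ((paraL m).comp (bar m)).contDiff.contDiffAt)

/-- The exponent (m+1)/2 makes the |v|² terms cancel, through v̄ v = |v|². What is left is an
approximate identity for ε > 0 and zero for ε = 0. -/
theorem rightD_cauchyReg (ε : ℝ) (v : Para m) (hv : 0 < sqn v + ε) :
    rightD m (fderiv ℝ (cauchyReg ε) v) =
      ((m + 1) * ε * (sqn v + ε) ^ (-hexp m - 1)) • (1 : Cl m) := by
  have h : (sqn v + ε) ^ (-hexp m) = (sqn v + ε) ^ (-hexp m - 1) * (sqn v + ε) := by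
    rw [← Real.rpow_add_one hv.ne']; congr 1; ring
  rw [(hasFDerivAt_cauchyReg ε v hv).fderiv, map_add, map_smul, rightD_smulRight, map_smul,
    gradD_dotL, rightD_paraL_bar, mul_smul_comm, paraL_bar_mul, smul_smul, smul_smul, ← add_smul, h]
  congr 1
  unfold hexp; ring

/-- The conceptual reason: D = 2∂_0 - D̄, and the conjugate of D E = 0 says that D̄ annihilates Ē
from the right. The computation rests on v² = 2 v_0 v - |v|². This identity makes each term of the
Bergman kernel a derivative to which Green's formula applies. -/
theorem rightD_cauchyConj (v : Para m) (hv : 0 < sqn v + 0) :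
    rightD m (fderiv ℝ (cauchyConj) v) = (2 : ℝ) • conj (cauchyDer v) := by
  have h : (sqn v + 0) ^ (-hexp m) = (sqn v + 0) ^ (-hexp m - 1) * (sqn v + 0) := by
    rw [← Real.rpow_add_one hv.ne']; congr 1; ring
  have h' : -(hexp m + 1) = -hexp m - 1 := by ring
  rw [(hasFDerivAt_cauchyConj v hv).fderiv, map_add, map_smul, rightD_smulRight, map_smul,
    gradD_dotL, rightD_paraL, mul_smul_comm, paraL_mul_self, conj_cauchyDer, h, h']
  unfold hexp
  module

/-- The Fréchet derivative of `cauchyDer`. -/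
def cauchyDerDeriv (v : Para m) : Para m →L[ℝ] Cl m :=
  ((-(2 * hexp m) * (sqn v + 0) ^ (-hexp m - 1)) • dotL v).smulRight (1 : Cl m) -
    (((m + 1 : ℝ) * (v.1 * (sqn v + 0) ^ (-(hexp m + 1)))) • (paraL m).comp (bar m) +
      ((m + 1 : ℝ) • (v.1 • ((-(2 * (hexp m + 1)) * (sqn v + 0) ^ (-(hexp m + 1) - 1)) • dotL v) +
        (sqn v + 0) ^ (-(hexp m + 1)) • ContinuousLinearMap.fst ℝ _ _)).smulRight
          (paraL m (bar m v)))

theorem hasFDerivAt_cauchyDer (v : Para m) (hv : 0 < sqn v + 0) :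
    HasFDerivAt (cauchyDer : Para m → Cl m) (cauchyDerDeriv v) v :=
  ((hasFDerivAt_sqn_rpow _ 0 v hv).smul_const (1 : Cl m)).sub
    ((((hasFDerivAt_fst (𝕜 := ℝ) (p := v)).mul
      (hasFDerivAt_sqn_rpow (hexp m + 1) 0 v hv)).const_mul (m + 1 : ℝ)).smul
        ((paraL m).comp (bar m)).hasFDerivAt)

/-- ∂_0 E is monogenic because ∂_0 commutes with D. The verification uses v v̄ = |v|² and v + v̄ = 2
v_0. -/
theorem leftD_cauchyDerDeriv (v : Para m) (hv : 0 < sqn v + 0) :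
    leftD m (cauchyDerDeriv v) = 0 := by
  have h' : -(hexp m + 1) = -hexp m - 1 := by ring
  have h : (sqn v + 0) ^ (-hexp m - 1) = (sqn v + 0) ^ (-hexp m - 1 - 1) * (sqn v + 0) := by
    rw [← Real.rpow_add_one hv.ne']; congr 1; ring
  have h2 : paraL m (bar m v) = (2 * v.1) • (1 : Cl m) - paraL m v := by
    rw [← paraL_add_bar]; abel
  simp only [cauchyDerDeriv, map_sub, map_add, leftD_smulRight, map_smul, gradD_dotL, gradD_fst,
    leftD_paraL_bar, add_mul, smul_mul_assoc, paraL_mul_bar, h', one_mul, mul_one]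
  rw [h, h2]
  unfold hexp
  module

theorem fderiv_cauchyReg_zero_apply (v : Para m) (hv : 0 < sqn v + 0) :
    fderiv ℝ (cauchyReg 0) v (1, 0) = cauchyDer v := by
  have h' : -(hexp m + 1) = -hexp m - 1 := by ring
  rw [(hasFDerivAt_cauchyReg 0 v hv).fderiv, cauchyDer, h']
  simp only [add_apply, smul_apply,
    ContinuousLinearMap.comp_apply, ContinuousLinearMap.smulRight_apply, dotL_apply, paraL_bar]
  simp
  unfold hexp
  module

theorem sqn_rpow_eq (v : Para m) (k : ℕ) :
    (sqn v + 0) ^ (-((k : ℝ) / 2)) = (√(sqn v) ^ k)⁻¹ := by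
  rw [add_zero, Real.rpow_neg (sqn_nonneg v), Real.sqrt_eq_rpow, ← Real.rpow_natCast,
    ← Real.rpow_mul (sqn_nonneg v)]
  congr 2; ring

theorem norm_cauchyReg_zero_le (v : Para m) :
    ‖cauchyReg 0 v‖ ≤ (m + 1) * (√(sqn v) ^ m)⁻¹ := by
  have h := sqn_rpow_eq v (m + 1)
  push_cast at h
  rw [cauchyReg, norm_smul, h, Real.norm_of_nonneg (by positivity)]
  rcases (Real.sqrt_nonneg (sqn v)).eq_or_lt with h0 | h0
  · rw [← h0]; simp; positivity
  · calc _ ≤ (√(sqn v) ^ (m + 1))⁻¹ * ((m + 1) * √(sqn v)) := by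
          gcongr; exact norm_paraL_bar_le v
      _ = _ := by field_simp; ring

theorem norm_cauchyDer_le (v : Para m) :
    ‖cauchyDer v‖ ≤ (1 + (m + 1) ^ 2) * (√(sqn v) ^ (m + 1))⁻¹ := by
  have h := sqn_rpow_eq v (m + 1)
  have h3 : (sqn v + 0) ^ (-(hexp m + 1)) = (√(sqn v) ^ (m + 3))⁻¹ := by
    rw [← sqn_rpow_eq]; congr 2; push_cast [hexp]; ring
  push_cast at h
  rw [cauchyDer, h, h3]
  refine (norm_sub_le _ _).trans ?_
  rw [norm_smul, norm_smul, norm_one_cl, Real.norm_of_nonneg (by positivity), norm_mul, norm_mul,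
    Real.norm_of_nonneg (by positivity : 0 ≤ (√(sqn v) ^ (m + 3))⁻¹),
    Real.norm_of_nonneg (by positivity : (0 : ℝ) ≤ m + 1), Real.norm_eq_abs]
  rcases (Real.sqrt_nonneg (sqn v)).eq_or_lt with h0 | h0
  · rw [← h0]; simp
  · calc _ ≤ (√(sqn v) ^ (m + 1))⁻¹ * 1 +
          (m + 1) * (√(sqn v) * (√(sqn v) ^ (m + 3))⁻¹) * ((m + 1) * √(sqn v)) := by
          gcongr
          · exact abs_fst_le_sqrt_sqn v
          · exact norm_paraL_bar_le v
      _ = _ := by field_simp; ring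

theorem norm_cauchyDerDeriv_le (m : ℕ) : ∃ C : ℝ, 0 ≤ C ∧ ∀ v : Para m, 0 < sqn v →
    ‖cauchyDerDeriv v‖ ≤ C * (√(sqn v) ^ (m + 2))⁻¹ := by
  refine ⟨2 * (m + 1) + ((m + 1) * ‖(paraL m).comp (bar m)‖ +
    (m + 1) * (2 * (m + 3) + 1) * (m + 1)), by positivity, fun v hv => ?_⟩
  have hρ : 0 < √(sqn v) := Real.sqrt_pos.2 hv
  have h1 : (sqn v + 0) ^ (-hexp m - 1) = (√(sqn v) ^ (m + 3))⁻¹ := by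
    rw [← sqn_rpow_eq]; congr 1; push_cast [hexp]; ring
  have h2 : (sqn v + 0) ^ (-(hexp m + 1)) = (√(sqn v) ^ (m + 3))⁻¹ := by
    rw [← sqn_rpow_eq]; congr 1; push_cast [hexp]; ring
  have h3 : (sqn v + 0) ^ (-(hexp m + 1) - 1) = (√(sqn v) ^ (m + 5))⁻¹ := by
    rw [← sqn_rpow_eq]; congr 1; push_cast [hexp]; ring
  rw [cauchyDerDeriv, h1, h2, h3]
  have hf : ‖ContinuousLinearMap.fst ℝ ℝ (EuclideanSpace ℝ (Fin m))‖ ≤ 1 :=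
    ContinuousLinearMap.norm_fst_le ..
  have hd := norm_dotL_le v
  have hv1 := abs_fst_le_sqrt_sqn v
  have hp := norm_paraL_bar_le v
  have e1 : ‖(-(2 * hexp m) * (√(sqn v) ^ (m + 3))⁻¹)‖ = (m + 1) * (√(sqn v) ^ (m + 3))⁻¹ := by
    have : 0 ≤ hexp m := by unfold hexp; positivity
    rw [norm_mul, norm_neg, Real.norm_of_nonneg (by positivity), Real.norm_of_nonneg (by positivity)]
    unfold hexp; ring
  have e2 : ‖(-(2 * (hexp m + 1)) * (√(sqn v) ^ (m + 5))⁻¹)‖ =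
      (m + 3) * (√(sqn v) ^ (m + 5))⁻¹ := by
    have : 0 ≤ hexp m := by unfold hexp; positivity
    rw [norm_mul, norm_neg, Real.norm_of_nonneg (by positivity), Real.norm_of_nonneg (by positivity)]
    unfold hexp; ring
  have n1 : ‖((-(2 * hexp m) * (√(sqn v) ^ (m + 3))⁻¹) • dotL v).smulRight (1 : Cl m)‖ ≤
      2 * (m + 1) * (√(sqn v) ^ (m + 2))⁻¹ := by
    rw [ContinuousLinearMap.norm_smulRight_apply, norm_smul, norm_one_cl, e1]
    calc _ ≤ (m + 1) * (√(sqn v) ^ (m + 3))⁻¹ * (2 * √(sqn v)) * 1 := by gcongr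
      _ = _ := by field_simp; ring
  have n2 : ‖((m + 1 : ℝ) * (v.1 * (√(sqn v) ^ (m + 3))⁻¹)) • (paraL m).comp (bar m)‖ ≤
      (m + 1) * ‖(paraL m).comp (bar m)‖ * (√(sqn v) ^ (m + 2))⁻¹ := by
    rw [norm_smul, norm_mul, norm_mul, Real.norm_eq_abs v.1,
      Real.norm_of_nonneg (by positivity : 0 ≤ (√(sqn v) ^ (m + 3))⁻¹),
      Real.norm_of_nonneg (by positivity : (0 : ℝ) ≤ m + 1)]
    calc _ ≤ (m + 1) * (√(sqn v) * (√(sqn v) ^ (m + 3))⁻¹) * ‖(paraL m).comp (bar m)‖ := by gcongr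
      _ = _ := by field_simp; ring
  have n3 : ‖((m + 1 : ℝ) • (v.1 • ((-(2 * (hexp m + 1)) * (√(sqn v) ^ (m + 5))⁻¹) • dotL v) +
        (√(sqn v) ^ (m + 3))⁻¹ • ContinuousLinearMap.fst ℝ _ _)).smulRight
          (paraL m (bar m v))‖ ≤ (m + 1) * (2 * (m + 3) + 1) * (m + 1) * (√(sqn v) ^ (m + 2))⁻¹ := by
    rw [ContinuousLinearMap.norm_smulRight_apply, norm_smul,
      Real.norm_of_nonneg (by positivity : (0 : ℝ) ≤ m + 1)]
    have : ‖v.1 • ((-(2 * (hexp m + 1)) * (√(sqn v) ^ (m + 5))⁻¹) • dotL v) +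
        (√(sqn v) ^ (m + 3))⁻¹ • ContinuousLinearMap.fst ℝ ℝ (EuclideanSpace ℝ (Fin m))‖ ≤
        (2 * (m + 3) + 1) * (√(sqn v) ^ (m + 3))⁻¹ := by
      refine (norm_add_le _ _).trans ?_
      rw [norm_smul, norm_smul, norm_smul, e2, Real.norm_eq_abs,
        Real.norm_of_nonneg (by positivity : 0 ≤ (√(sqn v) ^ (m + 3))⁻¹)]
      calc _ ≤ √(sqn v) * ((m + 3) * (√(sqn v) ^ (m + 5))⁻¹ * (2 * √(sqn v))) +
            (√(sqn v) ^ (m + 3))⁻¹ * 1 := by gcongr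
        _ = _ := by field_simp; ring
    calc _ ≤ (m + 1) * ((2 * (m + 3) + 1) * (√(sqn v) ^ (m + 3))⁻¹) * ((m + 1) * √(sqn v)) := by
          gcongr
      _ = _ := by field_simp; ring
  refine (norm_sub_le _ _).trans ?_
  refine (add_le_add n1 ((norm_add_le _ _).trans (add_le_add n2 n3))).trans (le_of_eq ?_)
  ring

end Calculus

open MeasureTheory

/-! ### Integration with compactly supported cutoffs -/

section Cutoff

variable {V : Type*} [NormedAddCommGroup V] [NormedSpace ℝ V]
  {F : Type*} [NormedAddCommGroup F] [NormedSpace ℝ F]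

theorem contDiff_smul_of_tsupport_subset {Ω : Set V} (hΩ : IsOpen Ω) {χ : V → ℝ}
    (hχ : ContDiff ℝ 1 χ) (hs : tsupport χ ⊆ Ω) {g : V → F} (hg : ContDiffOn ℝ 1 g Ω) :
    ContDiff ℝ 1 fun w => χ w • g w := by
  rw [contDiff_iff_contDiffAt]
  intro w
  by_cases hw : w ∈ Ω
  · exact hχ.contDiffAt.smul (hg.contDiffAt (hΩ.mem_nhds hw))
  · have h : χ =ᶠ[nhds w] 0 := notMem_tsupport_iff_eventuallyEq.1 fun h => hw (hs h)
    refine (contDiffAt_const (c := (0 : F))).congr_of_eventuallyEq ?_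
    filter_upwards [h] with y hy
    simp [hy]

theorem integrable_of_continuousOn_of_eq_zero {V F : Type*} [TopologicalSpace V] [T2Space V]
    [NormedAddCommGroup F] [MeasurableSpace V] [BorelSpace V]
    {μ : Measure V} [IsFiniteMeasureOnCompacts μ]
    {K : Set V} (hK : IsCompact K) {h : V → F} (hc : ContinuousOn h K) (h0 : ∀ w ∉ K, h w = 0) :
    Integrable h μ :=
  (integrableOn_iff_integrable_of_support_subset
    (Function.support_subset_iff'.2 h0)).1 (hc.integrableOn_compact hK)

theorem integrable_fderiv_apply [MeasurableSpace V] [BorelSpace V]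
    {μ : Measure V} [IsFiniteMeasureOnCompacts μ] {g : V → F} (hg : ContDiff ℝ 1 g)
    (hs : HasCompactSupport g) (v : V) : Integrable (fun w => fderiv ℝ g w v) μ :=
  ((hg.continuous_fderiv one_ne_zero).clm_apply continuous_const).integrable_of_hasCompactSupport
    (hs.fderiv_apply (𝕜 := ℝ) v)

theorem integral_fderiv_eq_zero [MeasurableSpace V] [BorelSpace V] [FiniteDimensional ℝ V]
    {μ : Measure V} [μ.IsAddHaarMeasure] {g : V → F} (hg : ContDiff ℝ 1 g)
    (hs : HasCompactSupport g) (v : V) : ∫ w, fderiv ℝ g w v ∂μ = 0 := by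
  -- Integration by parts against the constant function 1.
  have h := integral_smul_fderiv_eq_neg_fderiv_smul_of_integrable (μ := μ) (𝕜 := ℝ)
    (f := fun _ : V => (1 : ℝ)) (g := g) (v := v) (by simp)
    (by simpa using (integrable_fderiv_apply hg hs v))
    (by simpa using hg.continuous.integrable_of_hasCompactSupport hs)
    (fun _ _ => differentiableAt_const _) (fun x _ => hg.differentiable one_ne_zero x)
  simpa using h

end Cutoff

/-! ### Green's formula for the Dirac operator -/

section Stokes

variable {m : ℕ} {a : ℝ}

instance instIsAddHaarMeasurePara : (volume : Measure (Para m)).IsAddHaarMeasure := by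
  rw [Measure.volume_eq_prod]; infer_instance

theorem isOpen_strip (m : ℕ) (a : ℝ) : IsOpen (strip m a) :=
  isOpen_lt (continuous_abs.comp continuous_fst) continuous_const

theorem hasFDerivAt_mul {A B : Para m → Cl m} {A' B' : Para m →L[ℝ] Cl m} {w : Para m}
    (hA : HasFDerivAt A A' w) (hB : HasFDerivAt B B' w) :
    HasFDerivAt (fun w => A w * B w)
      ((mulL m (A w)).comp B' + ((mulL m).flip (B w)).comp A') w :=
  ((mulL m).hasFDerivAt_of_bilinear hA hB).congr_fderiv (ContinuousLinearMap.ext fun _ => rfl)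

theorem contDiffOn_mul {A B : Para m → Cl m} {s : Set (Para m)} {n : WithTop ℕ∞}
    (hA : ContDiffOn ℝ n A s) (hB : ContDiffOn ℝ n B s) :
    ContDiffOn ℝ n (fun w => A w * B w) s :=
  ((mulL m).contDiff.comp_contDiffOn hA).clm_apply hB

theorem continuousOn_mul {A B : Para m → Cl m} {s : Set (Para m)}
    (hA : ContinuousOn A s) (hB : ContinuousOn B s) : ContinuousOn (fun w => A w * B w) s :=
  ((mulL m).continuous.comp_continuousOn hA).clm_apply hB

/-- The integrand is the derivative along v of χ A c f, extended by zero outside Ω. The constant c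
is the Clifford unit attached to the direction v; summing over the directions assembles the Dirac
operator between A and f. -/
theorem integral_dir_eq_zero {Ω : Set (Para m)} (hΩ : IsOpen Ω)
    {f : Para m → Cl m} (hf : ContDiffOn ℝ 1 f Ω) {χ : Para m → ℝ}
    (hχ : ContDiff ℝ 1 χ) (hc : HasCompactSupport χ) (hs : tsupport χ ⊆ Ω)
    {A : Para m → Cl m} (hA : ContDiffOn ℝ 1 A Ω) (v : Para m) (c : Cl m) :
    Integrable (fun w => fderiv ℝ χ w v • (A w * c * f w) +
      χ w • (fderiv ℝ A w v * c * f w + A w * c * fderiv ℝ f w v)) ∧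
    ∫ w, (fderiv ℝ χ w v • (A w * c * f w) +
      χ w • (fderiv ℝ A w v * c * f w + A w * c * fderiv ℝ f w v)) = 0 := by
  have hg : ContDiffOn ℝ 1 (fun w => A w * c * f w) Ω :=
    contDiffOn_mul (contDiffOn_mul hA contDiffOn_const) hf
  have hG := contDiff_smul_of_tsupport_subset hΩ hχ hs hg
  have hGs : HasCompactSupport fun w => χ w • (A w * c * f w) := hc.smul_right
  have key : ∀ w, fderiv ℝ (fun w => χ w • (A w * c * f w)) w v =
      fderiv ℝ χ w v • (A w * c * f w) +
      χ w • (fderiv ℝ A w v * c * f w + A w * c * fderiv ℝ f w v) := fun w => by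
    by_cases hw : w ∈ Ω
    · have hA' := ((hA.differentiableOn one_ne_zero).differentiableAt (hΩ.mem_nhds hw)).hasFDerivAt
      have hf' := ((hf.differentiableOn one_ne_zero).differentiableAt (hΩ.mem_nhds hw)).hasFDerivAt
      have hχ' := (hχ.differentiable one_ne_zero w).hasFDerivAt
      have := hχ'.smul (hasFDerivAt_mul (hasFDerivAt_mul hA' (hasFDerivAt_const c w)) hf')
      rw [HasFDerivAt.fderiv (f := fun w => χ w • (A w * c * f w)) this]
      simp
      abel
    · have h : χ =ᶠ[nhds w] 0 := notMem_tsupport_iff_eventuallyEq.1 fun h => hw (hs h)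
      have h2 : (fun w => χ w • (A w * c * f w)) =ᶠ[nhds w] fun _ => 0 := by
        filter_upwards [h] with y hy
        simp [hy]
      rw [h2.fderiv_eq, h.fderiv_eq, h.self_of_nhds]
      simp
  simp_rw [← key]
  exact ⟨integrable_fderiv_apply hG hGs v, integral_fderiv_eq_zero hG hGs v⟩

/-- Green's formula for the Dirac operator with a cutoff function. -/
theorem integral_rightD_mul {Ω : Set (Para m)} (hΩ : IsOpen Ω)
    {f : Para m → Cl m} (hf : LeftMonogenicOn f Ω) {χ : Para m → ℝ}
    (hχ : ContDiff ℝ 1 χ) (hc : HasCompactSupport χ) (hs : tsupport χ ⊆ Ω)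
    {A : Para m → Cl m} (hA : ContDiffOn ℝ 1 A Ω) :
    ∫ w, χ w • (rightD m (fderiv ℝ A w) * f w) = -∫ w, A w * gradD m (fderiv ℝ χ w) * f w := by
  have h0 := integral_dir_eq_zero hΩ hf.1 hχ hc hs hA (1, 0) 1
  have hj := fun j : Fin m => integral_dir_eq_zero hΩ hf.1 hχ hc hs hA (basisVec j) (e j)
  have hsum := integral_add h0.1 (integrable_finsetSum Finset.univ fun j _ => (hj j).1)
  rw [integral_finsetSum _ fun j _ => (hj j).1, h0.2,
    Finset.sum_eq_zero fun j _ => (hj j).2, add_zero] at hsum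
  have hχc : Continuous fun w => fderiv ℝ χ w := hχ.continuous_fderiv one_ne_zero
  have hAc : ContinuousOn (fun w => fderiv ℝ A w) Ω := hA.continuousOn_fderiv_of_isOpen hΩ le_rfl
  have hX : Integrable fun w => χ w • (rightD m (fderiv ℝ A w) * f w) := by
    refine integrable_of_continuousOn_of_eq_zero hc ?_ fun w hw => by
      simp [image_eq_zero_of_notMem_tsupport hw]
    exact hχ.continuous.continuousOn.smul (continuousOn_mul
      ((rightD m).continuous.comp_continuousOn (hAc.mono hs)) (hf.1.continuousOn.mono hs))
  have hY : Integrable fun w => A w * gradD m (fderiv ℝ χ w) * f w := by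
    refine integrable_of_continuousOn_of_eq_zero hc ?_ fun w hw => by
      have h : χ =ᶠ[nhds w] 0 := notMem_tsupport_iff_eventuallyEq.1 hw
      rw [h.fderiv_eq]
      simp
    exact continuousOn_mul (continuousOn_mul (hA.continuousOn.mono hs)
      ((gradD m).continuous.comp hχc).continuousOn) (hf.1.continuousOn.mono hs)
  rw [eq_neg_iff_add_eq_zero, ← integral_add hX hY, ← hsum]
  refine integral_congr_ae (Filter.Eventually.of_forall fun w => ?_)
  by_cases hw : w ∈ tsupport χ
  · have hd := hf.2 w (hs hw)
    rw [dirac_eq_leftD] at hd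
    have : A w * leftD m (fderiv ℝ f w) = 0 := by rw [hd, mul_zero]
    rw [leftD_apply, mul_add, Finset.mul_sum] at this
    simp only [rightD_apply, gradD_apply, add_mul, mul_add, Finset.sum_mul, Finset.mul_sum,
      smul_mul_assoc, mul_smul_comm, mul_one, smul_add, Finset.smul_sum, Finset.sum_add_distrib]
    rw [← sub_eq_zero]
    simp only [← mul_assoc] at this
    -- These are the terms in which the derivative falls on f; they vanish because f is monogenic.
    have h2 : χ w • (A w * (fderiv ℝ f w (1, 0)) + ∑ i, A w * e i * fderiv ℝ f w (basisVec i)) = 0 := by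
      rw [this, smul_zero]
    rw [smul_add, Finset.smul_sum] at h2
    rw [← neg_eq_zero, ← h2]
    abel
  · have h : χ =ᶠ[nhds w] 0 := notMem_tsupport_iff_eventuallyEq.1 hw
    simp [h.fderiv_eq, h.self_of_nhds]

end Stokes

open Filter Topology

/-! ### The Cauchy–Pompeiu formula -/

section Pompeiu

variable {m : ℕ} {a : ℝ}

/-- The norm of the product space is the maximum norm, so there is no equality with the Euclidean
one. -/
theorem norm_sq_le_sqn (v : Para m) : ‖v‖ ^ 2 ≤ sqn v := by
  rw [sqn, Prod.norm_def, Real.norm_eq_abs]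
  rcases max_cases |v.1| ‖v.2‖ with h | h <;> rw [h.1]
  · rw [sq_abs]; nlinarith [sq_nonneg ‖v.2‖]
  · nlinarith [sq_nonneg v.1]

theorem sqn_pos {v : Para m} (hv : v ≠ 0) : 0 < sqn v :=
  lt_of_lt_of_le (by positivity) (norm_sq_le_sqn v)

theorem sqn_smul (c : ℝ) (v : Para m) : sqn (c • v) = c ^ 2 * sqn v := by
  simp only [sqn, Prod.smul_fst, Prod.smul_snd, norm_smul, smul_eq_mul, mul_pow, Real.norm_eq_abs,
    sq_abs]
  ring

theorem sqn_neg (v : Para m) : sqn (-v) = sqn v := by simp [sqn]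

/-- The unnormalised bump which the Dirac operator makes of the regularised Cauchy kernel. -/
def bump (v : Para m) : ℝ := (m + 1) * (1 + sqn v) ^ (-hexp m - 1)

theorem bump_pos (v : Para m) : 0 < bump v :=
  mul_pos (by positivity) (Real.rpow_pos_of_pos (by linarith [sqn_nonneg v]) _)

theorem finrank_para (m : ℕ) : Module.finrank ℝ (Para m) = m + 1 := by
  rw [Module.finrank_prod, finrank_euclideanSpace_fin, Module.finrank_self, add_comm]

theorem continuous_bump : Continuous (bump : Para m → ℝ) :=
  continuous_const.mul ((continuous_const.add (contDiff_sqn (n := 1)).continuous).rpow_const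
    fun v => Or.inl (add_pos_of_pos_of_nonneg one_pos (sqn_nonneg v)).ne')

theorem integrable_bump : Integrable (bump : Para m → ℝ) := by
  have h := integrable_rpow_neg_one_add_norm_sq (E := Para m) (μ := volume) (r := m + 3)
    (by rw [finrank_para]; push_cast; linarith)
  refine (h.const_mul (m + 1)).mono' continuous_bump.aestronglyMeasurable
    (Eventually.of_forall fun v => ?_)
  rw [Real.norm_of_nonneg (bump_pos v).le, bump]
  have e : -((m : ℝ) + 3) / 2 = -hexp m - 1 := by unfold hexp; ring
  rw [e]
  refine mul_le_mul_of_nonneg_left ?_ (by positivity)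
  exact Real.rpow_le_rpow_of_nonpos (by positivity) (by linarith [norm_sq_le_sqn v])
    (by unfold hexp; linarith [(Nat.cast_nonneg m : (0 : ℝ) ≤ m)])

/-- The normalising constant of the Cauchy kernel. -/
def sigma (m : ℕ) : ℝ := ∫ v : Para m, bump v

theorem sigma_pos (m : ℕ) : 0 < sigma m := by
  rw [sigma, integral_pos_iff_support_of_nonneg (fun v => (bump_pos v).le) integrable_bump]
  have : Function.support (bump : Para m → ℝ) = Set.univ :=
    Set.eq_univ_of_forall fun v => (bump_pos v).ne'
  rw [this]
  exact Measure.measure_univ_pos.2 (NeZero.ne _)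

/-- The bump decays like the power -(m+3), which beats the dimension m+1. Together with total mass 1
after division by σ, this is what the approximate identity theorem requires. -/
theorem tendsto_norm_pow_mul_bump :
    Tendsto (fun v : Para m => ‖v‖ ^ Module.finrank ℝ (Para m) * ((sigma m)⁻¹ * bump v))
      (Bornology.cobounded _) (𝓝 0) := by
  have h1 : Tendsto (fun v : Para m => (sigma m)⁻¹ * (m + 1) * (‖v‖ ^ 2)⁻¹)
      (Bornology.cobounded _) (𝓝 0) := by
    have := ((tendsto_pow_atTop (α := ℝ) two_ne_zero).comp
      (tendsto_norm_cobounded_atTop (E := Para m))).inv_tendsto_atTop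
    simpa using this.const_mul ((sigma m)⁻¹ * (m + 1))
  have hσ := sigma_pos m
  refine squeeze_zero' (Eventually.of_forall fun v => ?_) ?_ h1
  · have := bump_pos v; positivity
  · filter_upwards [(tendsto_norm_cobounded_atTop (E := Para m)).eventually_gt_atTop 0] with v hv
    have h2 : (1 + sqn v) ^ (-hexp m - 1) ≤ (‖v‖ ^ (m + 3))⁻¹ := by
      have : (‖v‖ ^ (m + 3))⁻¹ = (‖v‖ ^ 2) ^ (-hexp m - 1) := by
        rw [← Real.rpow_natCast, ← Real.rpow_natCast, ← Real.rpow_mul hv.le,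
          ← Real.rpow_neg hv.le]
        congr 1; push_cast [hexp]; ring
      rw [this]
      exact Real.rpow_le_rpow_of_nonpos (by positivity) (by linarith [norm_sq_le_sqn v])
        (by unfold hexp; linarith [(Nat.cast_nonneg m : (0 : ℝ) ≤ m)])
    rw [finrank_para, bump]
    calc _ ≤ ‖v‖ ^ (m + 1) * ((sigma m)⁻¹ * ((m + 1) * (‖v‖ ^ (m + 3))⁻¹)) := by gcongr
      _ = _ := by field_simp; ring

theorem norm_cauchyReg_le (ε : ℝ) (hε : 0 ≤ ε) (v : Para m) (hv : 0 < sqn v) :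
    ‖cauchyReg ε v‖ ≤ (m + 1) * (√(sqn v) ^ m)⁻¹ := by
  refine le_trans ?_ (norm_cauchyReg_zero_le v)
  rw [cauchyReg, cauchyReg, norm_smul, norm_smul,
    Real.norm_of_nonneg (Real.rpow_nonneg (by linarith) _),
    Real.norm_of_nonneg (Real.rpow_nonneg (by linarith) _)]
  refine mul_le_mul_of_nonneg_right ?_ (norm_nonneg _)
  exact Real.rpow_le_rpow_of_nonpos (by linarith) (by linarith)
    (by unfold hexp; linarith [(Nat.cast_nonneg m : (0 : ℝ) ≤ m)])

theorem norm_mul_mul_le (x y z : Cl m) : ‖x * y * z‖ ≤ ‖mulL m‖ ^ 2 * ‖x‖ * ‖y‖ * ‖z‖ := by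
  refine (norm_mul_le_mulL _ _).trans ?_
  calc _ ≤ ‖mulL m‖ * (‖mulL m‖ * ‖x‖ * ‖y‖) * ‖z‖ := by gcongr; exact norm_mul_le_mulL _ _
    _ = _ := by ring

theorem fderiv_eq_zero_of_notMem_tsupport {χ : Para m → ℝ} {w : Para m} (hw : w ∉ tsupport χ) :
    fderiv ℝ χ w = 0 := by
  have h : χ =ᶠ[nhds w] 0 := notMem_tsupport_iff_eventuallyEq.1 hw
  rw [h.fderiv_eq]
  exact (hasFDerivAt_const (0 : ℝ) w).fderiv

theorem integrable_mul_gradD_mul {χ : Para m → ℝ} (hχ : ContDiff ℝ 1 χ) {K : Set (Para m)}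
    (hK : IsCompact K) (h0 : ∀ w ∉ K, fderiv ℝ χ w = 0)
    {A f : Para m → Cl m} (hA : ContinuousOn A K) (hf : ContinuousOn f K) :
    Integrable fun w => A w * gradD m (fderiv ℝ χ w) * f w := by
  refine integrable_of_continuousOn_of_eq_zero hK ?_ fun w hw => by simp [h0 w hw]
  exact continuousOn_mul (continuousOn_mul hA
    ((gradD m).continuous.comp (hχ.continuous_fderiv one_ne_zero)).continuousOn) hf

theorem integrable_mul_norm_gradD_mul {χ : Para m → ℝ} (hχ : ContDiff ℝ 1 χ)
    (hc : HasCompactSupport χ) {f : Para m → Cl m} (hf : ContinuousOn f (tsupport χ))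
    {g : Para m → ℝ} (hg : Continuous g) :
    Integrable fun w => g w * (‖gradD m (fderiv ℝ χ w)‖ * ‖f w‖) := by
  refine integrable_of_continuousOn_of_eq_zero hc ?_ fun w hw => by
    simp [fderiv_eq_zero_of_notMem_tsupport hw]
  exact hg.continuousOn.mul
    (((gradD m).continuous.comp (hχ.continuous_fderiv one_ne_zero)).norm.continuousOn.mul hf.norm)

/-- The Cauchy–Pompeiu formula for a cutoff function that is locally constant near the point. -/
theorem sigma_smul_eq_integral {Ω : Set (Para m)} (hΩ : IsOpen Ω)
    {f : Para m → Cl m} (hf : LeftMonogenicOn f Ω) {χ : Para m → ℝ}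
    (hχ : ContDiff ℝ 1 χ) (hc : HasCompactSupport χ) (hs : tsupport χ ⊆ Ω)
    {x : Para m} {δ : ℝ} (hδ : 0 < δ) (hδχ : ∀ w, ‖w - x‖ < δ → fderiv ℝ χ w = 0) :
    sigma m • (χ x • f x) =
      -∫ w, cauchyReg 0 (w - x) * gradD m (fderiv ℝ χ w) * f w := by
  have hfc : ContinuousOn f (tsupport χ) := hf.1.continuousOn.mono hs
  have hσ := sigma_pos m
  -- Green's formula for the kernel regularised with ε = c⁻²: its right Dirac derivative is the bump
  -- rescaled by c. As c → ∞ the left side concentrates at x and the right side loses the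
  -- regularisation.
  have key : ∀ c : ℝ, 0 < c → sigma m • ∫ w, (c ^ Module.finrank ℝ (Para m) *
      ((sigma m)⁻¹ * bump (c • (x - w)))) • (χ w • f w) =
      -∫ w, cauchyReg ((c ^ 2)⁻¹) (w - x) * gradD m (fderiv ℝ χ w) * f w := fun c hc0 => by
    have hpos : ∀ v : Para m, 0 < sqn v + (c ^ 2)⁻¹ := fun v => by
      have := sqn_nonneg v; positivity
    rw [← integral_rightD_mul hΩ hf hχ hc hs (A := fun w => cauchyReg ((c ^ 2)⁻¹) (w - x))
      (ContDiff.contDiffOn (contDiff_iff_contDiffAt.2 fun w =>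
        (contDiffAt_cauchyReg _ _ (hpos _)).comp w (contDiff_id.sub contDiff_const).contDiffAt)),
      ← integral_smul]
    refine integral_congr_ae (Eventually.of_forall fun w => ?_)
    have e : fderiv ℝ (fun w => cauchyReg ((c ^ 2)⁻¹) (w - x)) w =
        fderiv ℝ (cauchyReg ((c ^ 2)⁻¹)) (w - x) := by
      simpa [sub_eq_add_neg] using fderiv_comp_add_right (f := cauchyReg ((c ^ 2)⁻¹)) (x := w) (-x)
    have e2 : bump (c • (x - w)) =
        (m + 1) * ((sqn (w - x) + (c ^ 2)⁻¹) ^ (-hexp m - 1) * (c ^ (m + 3))⁻¹) := by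
      have h3 : (c ^ (m + 3))⁻¹ = (c ^ 2) ^ (-hexp m - 1) := by
        rw [← Real.rpow_natCast, ← Real.rpow_natCast, ← Real.rpow_mul hc0.le,
          ← Real.rpow_neg hc0.le]
        congr 1; push_cast [hexp]; ring
      rw [bump, h3, ← Real.mul_rpow (hpos _).le (by positivity), sqn_smul, ← neg_sub w x, sqn_neg]
      congr 2
      field_simp
      ring
    simp only []
    rw [e, rightD_cauchyReg _ _ (hpos _), smul_mul_assoc, one_mul, finrank_para, e2, smul_smul,
      smul_smul, smul_smul]
    congr 1
    field_simp
    ring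
  have lim1 : Tendsto (fun c : ℝ => sigma m • ∫ w, (c ^ Module.finrank ℝ (Para m) *
      ((sigma m)⁻¹ * bump (c • (x - w)))) • (χ w • f w)) atTop (𝓝 (sigma m • (χ x • f x))) := by
    refine Tendsto.const_smul ?_ _
    have hcont := contDiff_smul_of_tsupport_subset hΩ hχ hs hf.1
    refine tendsto_integral_comp_smul_smul_of_integrable' (g := fun w => χ w • f w)
      (φ := fun v : Para m => (sigma m)⁻¹ * bump v)
      (fun v => ?_) ?_ tendsto_norm_pow_mul_bump ?_ ?_
    · have := bump_pos v; positivity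
    · rw [integral_const_mul]; exact inv_mul_cancel₀ hσ.ne'
    · exact hcont.continuous.integrable_of_hasCompactSupport hc.smul_right
    · exact hcont.continuous.continuousAt
  -- The gradient of χ vanishes on the δ-ball at x, so the pole is never met and the kernels are
  -- bounded there by their value at distance δ, uniformly in c.
  have lim2 : Tendsto (fun c : ℝ => -∫ w, cauchyReg ((c ^ 2)⁻¹) (w - x) *
      gradD m (fderiv ℝ χ w) * f w) atTop
      (𝓝 (-∫ w, cauchyReg 0 (w - x) * gradD m (fderiv ℝ χ w) * f w)) := by
    refine Tendsto.neg ?_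
    refine tendsto_integral_filter_of_dominated_convergence
      (fun w => ‖mulL m‖ ^ 2 * ((m + 1) * (δ ^ m)⁻¹) * (‖gradD m (fderiv ℝ χ w)‖ * ‖f w‖)) ?_ ?_ ?_ ?_
    · filter_upwards [eventually_gt_atTop 0] with c hc0
      have hpos : ∀ v : Para m, 0 < sqn v + (c ^ 2)⁻¹ := fun v => by
        have := sqn_nonneg v; positivity
      refine (integrable_mul_gradD_mul hχ hc
        (fun w hw => fderiv_eq_zero_of_notMem_tsupport hw) ?_ hfc).aestronglyMeasurable
      exact (continuous_iff_continuousAt.2 fun w =>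
        ((contDiffAt_cauchyReg (n := 1) _ _ (hpos _)).continuousAt.comp
          (f := fun w : Para m => w - x) (by fun_prop))).continuousOn
    · filter_upwards [eventually_gt_atTop 0] with c hc0
      refine Eventually.of_forall fun w => ?_
      by_cases hw : ‖w - x‖ < δ
      · simp [hδχ w hw]
      · have hδ' : δ ≤ √(sqn (w - x)) := (not_lt.1 hw).trans
          (Real.le_sqrt_of_sq_le (norm_sq_le_sqn _))
        have h1 := norm_cauchyReg_le ((c ^ 2)⁻¹) (by positivity) (w - x)
          (Real.sqrt_pos.1 (hδ.trans_le hδ'))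
        have h2 : ‖cauchyReg ((c ^ 2)⁻¹) (w - x)‖ ≤ (m + 1) * (δ ^ m)⁻¹ := by
          refine h1.trans ?_; gcongr
        refine (norm_mul_mul_le _ _ _).trans ?_
        rw [← mul_assoc]
        gcongr
    · exact integrable_mul_norm_gradD_mul hχ hc hfc continuous_const
    · refine Eventually.of_forall fun w => ?_
      by_cases hw : ‖w - x‖ < δ
      · simp [hδχ w hw]
      · have hq : 0 < sqn (w - x) :=
          lt_of_lt_of_le (by nlinarith [not_lt.1 hw, norm_nonneg (w - x)]) (norm_sq_le_sqn (w - x))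
        have t0 : Tendsto (fun c : ℝ => (c ^ 2)⁻¹) atTop (𝓝 0) :=
          (tendsto_pow_atTop two_ne_zero).inv_tendsto_atTop
        have t1 : Tendsto (fun c : ℝ => cauchyReg ((c ^ 2)⁻¹) (w - x)) atTop
            (𝓝 (cauchyReg 0 (w - x))) :=
          ((t0.const_add (sqn (w - x))).rpow_const (Or.inl (by simpa using hq.ne'))).smul_const _
        have hcont : Continuous fun z : Cl m => z * gradD m (fderiv ℝ χ w) * f w :=
          (((mulL m).flip (f w)).comp ((mulL m).flip (gradD m (fderiv ℝ χ w)))).continuous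
        exact (hcont.tendsto _).comp t1
  refine tendsto_nhds_unique (lim1.congr' ?_) lim2
  filter_upwards [eventually_gt_atTop 0] with c hc0 using key c hc0

end Pompeiu

/-! ### The series of images: convergence and membership in A² -/

section Kernel

variable {m : ℕ} {a : ℝ}

theorem summable_one_add_abs_int_rpow {β : ℝ} (hβ : 1 < β) :
    Summable fun n : ℤ => (1 + |(n : ℝ)|) ^ (-β) := by
  have h0 : Summable fun n : ℤ => (if n = 0 then (1 : ℝ) else 0) :=
    summable_of_ne_finset_zero (s := {0}) fun n hn => by simp_all
  refine Summable.of_nonneg_of_le (fun n => by positivity) (fun n => ?_)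
    (h0.add (Real.summable_abs_int_rpow hβ))
  by_cases hn : n = 0
  · subst hn
    simp
    positivity
  · have : (0 : ℝ) < |(n : ℝ)| := by positivity
    rw [if_neg hn, zero_add]
    exact Real.rpow_le_rpow_of_nonpos this (by linarith) (by linarith)

/-- Twice the first bound plus the second. It merges a bound away from zero with linear growth in
the image index. -/
theorem mul_one_add_div_three_le {d ρ k : ℝ} (h1 : d ≤ ρ) (h2 : d * (k - 1) ≤ ρ) :
    d / 3 * (1 + k) ≤ ρ := by
  linarith

/-- An odd multiple of 2a has absolute value at least 2a. -/
theorem two_mul_sub_abs_le (s : ℝ) (n : ℤ) (hs : |s| ≤ 2 * a) :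
    2 * a - |s| ≤ |s + 2 * a * (2 * n + 1)| := by
  have ha : 0 ≤ a := by linarith [abs_nonneg s]
  have h1 := neg_abs_le s
  have h2 := le_abs_self s
  rcases le_or_gt 0 n with hn | hn
  · have hn' : (0 : ℝ) ≤ n := by exact_mod_cast hn
    refine le_trans ?_ (le_abs_self _)
    nlinarith
  · have hn' : (n : ℝ) ≤ -1 := by exact_mod_cast Int.le_sub_one_of_lt hn
    refine le_trans ?_ (neg_le_abs _)
    nlinarith

theorem two_mul_mul_abs_sub_one_le (s : ℝ) (n : ℤ) (hs : |s| ≤ 2 * a) :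
    2 * a * (|(n : ℝ)| - 1) ≤ |s + 2 * a * (2 * n + 1)| := by
  have ha : 0 ≤ a := by linarith [abs_nonneg s]
  have h1 := neg_abs_le s
  have h2 := le_abs_self s
  rcases le_or_gt 0 n with hn | hn
  · have hn' : (0 : ℝ) ≤ n := by exact_mod_cast hn
    rw [abs_of_nonneg hn']
    refine le_trans ?_ (le_abs_self _)
    nlinarith
  · have hn' : (n : ℝ) ≤ -1 := by exact_mod_cast Int.le_sub_one_of_lt hn
    rw [abs_of_nonpos (by linarith : (n : ℝ) ≤ 0)]
    refine le_trans ?_ (neg_le_abs _)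
    nlinarith

/-- The translates `w + x̄ + 2a(2n+1)` at which the Cauchy kernel is evaluated. -/
def imagePt (a : ℝ) (x : Para m) (n : ℤ) (w : Para m) : Para m :=
  w + (x.1 + 2 * a * (2 * n + 1), -x.2)

theorem imagePt_fst (x : Para m) (n : ℤ) (w : Para m) :
    (imagePt a x n w).1 = w.1 + x.1 + 2 * a * (2 * n + 1) := by simp [imagePt]; ring

theorem imagePt_snd (x : Para m) (n : ℤ) (w : Para m) :
    (imagePt a x n w).2 = w.2 - x.2 := by simp [imagePt, sub_eq_add_neg]

/-- The Bergman kernel of the strip. -/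
def stripKernel (a : ℝ) (w x : Para m) : Cl m :=
  (-2 / sigma m) • ∑' n : ℤ, cauchyDer (imagePt a x n w)

/-- The square integrable decay of the Bergman kernel in the unbounded directions. -/
def decay (m : ℕ) (r : ℝ) : ℝ := (1 + r) ^ (-((m : ℝ) - 1 / 4))

theorem decay_nonneg {r : ℝ} (hr : 0 ≤ r) : 0 ≤ decay m r := by unfold decay; positivity

theorem decay_le_one (hm : 1 ≤ m) {r : ℝ} (hr : 0 ≤ r) : decay m r ≤ 1 := by
  have : (1 : ℝ) ≤ m := by exact_mod_cast hm
  exact Real.rpow_le_one_of_one_le_of_nonpos (by linarith) (by linarith)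

/-- The exponent is split as m + 1 = 5/4 + (m - 1/4). Since 5/4 > 1 the first part is summable over
the images, and since 2(m - 1/4) > m for m ≥ 1 the second part is square integrable over ℝ^m. -/
theorem inv_pow_le_mul_decay (hm : 1 ≤ m) {c ρ k r : ℝ} (hc : 0 < c) (hk : 0 ≤ k) (hr : 0 ≤ r)
    (h1 : c * (1 + k) ≤ ρ) (h2 : c * (1 + r) ≤ ρ) :
    (ρ ^ (m + 1))⁻¹ ≤ (c ^ (m + 1))⁻¹ * ((1 + k) ^ (-(5 / 4 : ℝ)) * decay m r) := by
  have hm' : (1 : ℝ) ≤ m := by exact_mod_cast hm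
  have hρ : 0 < ρ := lt_of_lt_of_le (by positivity) h1
  have e1 : ∀ t : ℝ, 0 < t → (t ^ (m + 1))⁻¹ = t ^ (-(5 / 4 : ℝ)) * t ^ (-((m : ℝ) - 1 / 4)) :=
    fun t ht => by
      rw [← Real.rpow_add ht, ← Real.rpow_natCast, ← Real.rpow_neg ht.le]
      congr 1; push_cast; ring
  rw [e1 ρ hρ, e1 c hc, decay]
  calc _ ≤ (c * (1 + k)) ^ (-(5 / 4 : ℝ)) * (c * (1 + r)) ^ (-((m : ℝ) - 1 / 4)) := by
        refine mul_le_mul ?_ ?_ (by positivity) (by positivity)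
        · exact Real.rpow_le_rpow_of_nonpos (by positivity) h1 (by norm_num)
        · exact Real.rpow_le_rpow_of_nonpos (by positivity) h2 (by linarith)
    _ = _ := by
        rw [Real.mul_rpow hc.le (by positivity), Real.mul_rpow hc.le (by positivity)]; ring

theorem abs_fst_add_le {w x : Para m} (hw : w ∈ strip m a) : |w.1 + x.1| ≤ a + |x.1| :=
  (abs_add_le _ _).trans (by linarith [show |w.1| < a from hw])

/-- For w in the strip, 2a - |w_0 + x_0| is at least a - |x_0|. Hence the images of x keep a
distance from w that depends on x alone, and c is uniform in w and n. -/
theorem imagePt_lower {x : Para m} (hx : x ∈ strip m a) : ∃ c : ℝ, 0 < c ∧ c ≤ 1 ∧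
    ∀ w ∈ strip m a, ∀ n : ℤ, c * (1 + |(n : ℝ)|) ≤ √(sqn (imagePt a x n w)) ∧
      c * (1 + ‖w.2 - x.2‖) ≤ √(sqn (imagePt a x n w)) := by
  have hx' : |x.1| < a := hx
  have ha : 0 < a := (abs_nonneg _).trans_lt hx'
  have hd : 0 < min 1 (a - |x.1|) := lt_min one_pos (by linarith)
  have hd1 : min 1 (a - |x.1|) ≤ 1 := min_le_left _ _
  have hd2 : min 1 (a - |x.1|) ≤ a - |x.1| := min_le_right _ _
  generalize min 1 (a - |x.1|) = d at hd hd1 hd2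
  refine ⟨d / 3, by positivity, by linarith, fun w hw n => ?_⟩
  have hs := abs_fst_add_le (x := x) hw
  have h0 := abs_fst_le_sqrt_sqn (imagePt a x n w)
  have hr := norm_snd_le_sqrt_sqn (imagePt a x n w)
  rw [imagePt_fst] at h0
  rw [imagePt_snd] at hr
  have h1 := two_mul_sub_abs_le (a := a) (w.1 + x.1) n (by linarith)
  have h2 := two_mul_mul_abs_sub_one_le (a := a) (w.1 + x.1) n (by linarith)
  have hdρ : d ≤ √(sqn (imagePt a x n w)) := by linarith
  refine ⟨mul_one_add_div_three_le hdρ ?_, ?_⟩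
  · rcases le_total (|(n : ℝ)|) 1 with h | h
    · nlinarith
    · have := abs_nonneg x.1
      nlinarith
  · have := norm_nonneg (w.2 - x.2)
    nlinarith

theorem sqn_imagePt_pos {x w : Para m} (hx : x ∈ strip m a) (hw : w ∈ strip m a) (n : ℤ) :
    0 < sqn (imagePt a x n w) := by
  obtain ⟨c, hc, -, h⟩ := imagePt_lower hx
  exact Real.sqrt_pos.1 (lt_of_lt_of_le (by positivity) (h w hw n).1)

theorem norm_cauchyDer_imagePt_le (hm : 1 ≤ m) {x : Para m} (hx : x ∈ strip m a) :
    ∃ C : ℝ, 0 ≤ C ∧ ∀ w ∈ strip m a, ∀ n : ℤ,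
      ‖cauchyDer (imagePt a x n w)‖ ≤
        C * decay m ‖w.2 - x.2‖ * (1 + |(n : ℝ)|) ^ (-(5 / 4 : ℝ)) := by
  obtain ⟨c, hc, -, h⟩ := imagePt_lower hx
  refine ⟨(1 + (m + 1) ^ 2) * (c ^ (m + 1))⁻¹, by positivity, fun w hw n => ?_⟩
  have h1 := inv_pow_le_mul_decay hm hc (abs_nonneg (n : ℝ)) (norm_nonneg (w.2 - x.2))
    (h w hw n).1 (h w hw n).2
  refine (norm_cauchyDer_le _).trans ?_
  calc _ ≤ (1 + (m + 1 : ℝ) ^ 2) * _ := mul_le_mul_of_nonneg_left h1 (by positivity)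
    _ = _ := by ring

/-- The extra power of the distance and the decay in w̲ are discarded: termwise differentiation only
needs a summable bound uniform in w. -/
theorem norm_cauchyDerDeriv_imagePt_le (hm : 1 ≤ m) {x : Para m} (hx : x ∈ strip m a) :
    ∃ C : ℝ, 0 ≤ C ∧ ∀ w ∈ strip m a, ∀ n : ℤ,
      ‖cauchyDerDeriv (imagePt a x n w)‖ ≤ C * (1 + |(n : ℝ)|) ^ (-(5 / 4 : ℝ)) := by
  obtain ⟨c, hc, -, h⟩ := imagePt_lower hx
  obtain ⟨C, hC, hC'⟩ := norm_cauchyDerDeriv_le m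
  refine ⟨C * (c⁻¹ * (c ^ (m + 1))⁻¹), by positivity, fun w hw n => ?_⟩
  have h1 := inv_pow_le_mul_decay hm hc (abs_nonneg (n : ℝ)) (norm_nonneg (w.2 - x.2))
    (h w hw n).1 (h w hw n).2
  have hρ : c ≤ √(sqn (imagePt a x n w)) := by
    nlinarith [(h w hw n).1, abs_nonneg (n : ℝ)]
  have hd := decay_le_one hm (norm_nonneg (w.2 - x.2))
  have hd' := decay_nonneg (m := m) (norm_nonneg (w.2 - x.2))
  refine (hC' _ (sqn_imagePt_pos hx hw n)).trans ?_
  rw [pow_succ _ (m + 1), mul_inv]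
  calc C * ((√(sqn (imagePt a x n w)) ^ (m + 1))⁻¹ * (√(sqn (imagePt a x n w)))⁻¹)
      ≤ C * ((c ^ (m + 1))⁻¹ * ((1 + |(n : ℝ)|) ^ (-(5 / 4 : ℝ)) * 1) * c⁻¹) := by
        gcongr
        refine h1.trans ?_
        gcongr
    _ = _ := by ring

theorem summable_five_fourths : Summable fun n : ℤ => (1 + |(n : ℝ)|) ^ (-(5 / 4 : ℝ)) :=
  summable_one_add_abs_int_rpow (by norm_num)

theorem summable_cauchyDer_imagePt (hm : 1 ≤ m) {x w : Para m} (hx : x ∈ strip m a)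
    (hw : w ∈ strip m a) : Summable fun n : ℤ => cauchyDer (imagePt a x n w) := by
  obtain ⟨C, hC, h⟩ := norm_cauchyDer_imagePt_le hm hx
  exact Summable.of_norm_bounded (summable_five_fourths.mul_left _) (h w hw)

theorem norm_stripKernel_le (hm : 1 ≤ m) {x : Para m} (hx : x ∈ strip m a) :
    ∃ C : ℝ, 0 ≤ C ∧ ∀ w ∈ strip m a, ‖stripKernel a w x‖ ≤ C * decay m ‖w.2 - x.2‖ := by
  obtain ⟨C, hC, h⟩ := norm_cauchyDer_imagePt_le hm hx
  refine ⟨‖-2 / sigma m‖ * (C * ∑' n : ℤ, (1 + |(n : ℝ)|) ^ (-(5 / 4 : ℝ))), ?_, fun w hw => ?_⟩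
  · have : 0 ≤ ∑' n : ℤ, (1 + |(n : ℝ)|) ^ (-(5 / 4 : ℝ)) := tsum_nonneg fun n => by positivity
    positivity
  · rw [stripKernel, norm_smul, mul_assoc]
    refine mul_le_mul_of_nonneg_left ?_ (norm_nonneg _)
    refine (tsum_of_norm_bounded (summable_five_fourths.mul_left _).hasSum (h w hw)).trans ?_
    rw [tsum_mul_left]
    exact le_of_eq (by ring)

theorem convex_strip (m : ℕ) (a : ℝ) : Convex ℝ (strip m a) := by
  have : strip m a = (ContinuousLinearMap.fst ℝ ℝ (EuclideanSpace ℝ (Fin m))) ⁻¹'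
      Set.Ioo (-a) a := by
    ext w; simp [strip, abs_lt]
  rw [this]
  exact (convex_Ioo _ _).linear_preimage (ContinuousLinearMap.fst ℝ ℝ _).toLinearMap

theorem hasFDerivAt_cauchyDer_imagePt {x w : Para m} (hx : x ∈ strip m a)
    (hw : w ∈ strip m a) (n : ℤ) :
    HasFDerivAt (fun w => cauchyDer (imagePt a x n w)) (cauchyDerDeriv (imagePt a x n w)) w :=
  HasFDerivAt.comp (g := cauchyDer) (f := imagePt a x n) (f' := ContinuousLinearMap.id ℝ _) w
    (hasFDerivAt_cauchyDer _ (by simpa using sqn_imagePt_pos hx hw n))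
    ((hasFDerivAt_id w).add_const _)

theorem contDiffOn_imagePt {A : Para m → Cl m}
    (hA : ∀ v, 0 < sqn v + 0 → ContDiffAt ℝ 1 A v) {x : Para m} (hx : x ∈ strip m a) (n : ℤ) :
    ContDiffOn ℝ 1 (fun w => A (imagePt a x n w)) (strip m a) := fun w hw =>
  (ContDiffAt.comp (g := A) (f := imagePt a x n) w
    (hA _ (by simpa using sqn_imagePt_pos hx hw n))
    (contDiff_id.add contDiff_const).contDiffAt).contDiffWithinAt

theorem hasFDerivAt_stripKernel (hm : 1 ≤ m) {x w : Para m} (hx : x ∈ strip m a)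
    (hw : w ∈ strip m a) :
    HasFDerivAt (fun w => stripKernel a w x)
      ((-2 / sigma m) • ∑' n : ℤ, cauchyDerDeriv (imagePt a x n w)) w := by
  obtain ⟨C, hC, h⟩ := norm_cauchyDerDeriv_imagePt_le hm hx
  exact (hasFDerivAt_tsum_of_isPreconnected (summable_five_fourths.mul_left C) (isOpen_strip m a)
    (convex_strip m a).isPreconnected (fun n w hw => hasFDerivAt_cauchyDer_imagePt hx hw n)
    (fun n w hw => h w hw n) hw (summable_cauchyDer_imagePt hm hx hw) hw).const_smul (-2 / sigma m)

theorem leftMonogenicOn_stripKernel (hm : 1 ≤ m) {x : Para m} (hx : x ∈ strip m a) :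
    LeftMonogenicOn (fun w => stripKernel a w x) (strip m a) := by
  obtain ⟨C, hC, h⟩ := norm_cauchyDerDeriv_imagePt_le hm hx
  constructor
  -- C¹ amounts to continuity of the derivative, which is a uniformly convergent series of
  -- continuous functions.
  · rw [← zero_add (1 : WithTop ℕ∞), contDiffOn_succ_iff_fderiv_of_isOpen (isOpen_strip m a)]
    refine ⟨fun w hw => (hasFDerivAt_stripKernel hm hx hw).differentiableAt.differentiableWithinAt,
      by simp, contDiffOn_zero.2 ?_⟩
    refine ContinuousOn.congr (f := fun w => (-2 / sigma m) •
      ∑' n : ℤ, cauchyDerDeriv (imagePt a x n w)) ?_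
      fun w hw => (hasFDerivAt_stripKernel hm hx hw).fderiv
    refine (continuousOn_const (c := -2 / sigma m)).smul (continuousOn_tsum (fun n => ?_)
      (summable_five_fourths.mul_left C) fun n w hw => h w hw n)
    exact ((contDiffOn_imagePt (fun v hv => contDiffAt_cauchyDer v hv) hx n).continuousOn_fderiv_of_isOpen
      (isOpen_strip m a) le_rfl).congr fun w hw => (hasFDerivAt_cauchyDer_imagePt hx hw n).fderiv.symm
  · intro w hw
    have hs : Summable fun n : ℤ => cauchyDerDeriv (imagePt a x n w) :=
      Summable.of_norm_bounded (summable_five_fourths.mul_left C) (h w hw)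
    rw [dirac_eq_leftD, (hasFDerivAt_stripKernel hm hx hw).fderiv, map_smul,
      (leftD m).map_tsum hs]
    have h0 : ∀ n : ℤ, leftD m (cauchyDerDeriv (imagePt a x n w)) = 0 := fun n =>
      leftD_cauchyDerDeriv _ (by simpa using sqn_imagePt_pos hx hw n)
    simp [h0]

theorem continuous_decay (y : EuclideanSpace ℝ (Fin m)) :
    Continuous fun w : Para m => decay m ‖w.2 - y‖ := by
  unfold decay
  exact (by fun_prop : Continuous fun w : Para m => 1 + ‖w.2 - y‖).rpow_const
    fun w => Or.inl (by positivity)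

theorem memLp_decay (hm : 1 ≤ m) (y : EuclideanSpace ℝ (Fin m)) :
    MemLp (fun w : Para m => decay m ‖w.2 - y‖) 2 (volume.restrict (strip m a)) := by
  have hm' : (1 : ℝ) ≤ m := by exact_mod_cast hm
  rw [memLp_two_iff_integrable_sq (continuous_decay y).aestronglyMeasurable]
  have hs : strip m a = Set.Ioo (-a) a ×ˢ Set.univ := by
    ext w; simp [strip, abs_lt]
  rw [hs, Measure.volume_eq_prod, ← Measure.prod_restrict, Measure.restrict_univ]
  -- The squared decay has exponent 2m - 1/2, which exceeds the dimension m because m ≥ 1.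
  have h1 : Integrable (fun z : EuclideanSpace ℝ (Fin m) => (1 + ‖z - y‖) ^ (-(2 * (m : ℝ) - 1 / 2))) :=
    (integrable_one_add_norm (μ := volume) (E := EuclideanSpace ℝ (Fin m))
      (r := 2 * (m : ℝ) - 1 / 2) (by
        rw [finrank_euclideanSpace_fin]; linarith)).comp_sub_right y
  have h2 : Integrable (fun _ : ℝ => (1 : ℝ)) (volume.restrict (Set.Ioo (-a) a)) :=
    integrable_const _
  refine (h2.mul_prod h1).congr (Eventually.of_forall fun w => ?_)
  simp only [one_mul, decay]
  rw [← Real.rpow_natCast, ← Real.rpow_mul (by positivity)]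
  congr 1; push_cast; ring

theorem memA2_stripKernel (hm : 1 ≤ m) {x : Para m} (hx : x ∈ strip m a) :
    MemA2 a fun w => stripKernel a w x := by
  have hmon := leftMonogenicOn_stripKernel hm hx
  obtain ⟨C, hC, h⟩ := norm_stripKernel_le hm hx
  have hmeas : MeasurableSet (strip m a) := (isOpen_strip m a).measurableSet
  refine ⟨hmon, ((memLp_decay hm x.2).const_mul C).mono'
    (hmon.1.continuousOn.aestronglyMeasurable hmeas) ?_⟩
  filter_upwards [ae_restrict_mem hmeas] with w hw using h w hw

end Kernel

/-! ### Uniqueness of the kernel and the two estimates -/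

section Bounds

variable {m : ℕ} {a : ℝ}

/-- Each kernel reproduces the other, and the two resulting integrals are conjugate. With B₁ = B₂
this is Hermitian symmetry; the two cases together give uniqueness. -/
theorem IsBergmanKernel.eq_conj {B₁ B₂ : Para m → Para m → Cl m} (h₁ : IsBergmanKernel m a B₁)
    (h₂ : IsBergmanKernel m a B₂) {w x : Para m} (hw : w ∈ strip m a) (hx : x ∈ strip m a) :
    B₁ w x = conj (B₂ x w) := by
  rw [h₂.reproducing (fun v => B₁ v x) (h₁.mem x hx) w hw,
    h₁.reproducing (fun v => B₂ v w) (h₂.mem w hw) x hx, ← conjL_apply,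
    ← (conjL m).integral_comp_comm]
  simp [conj_mul, conj_conj]

theorem IsBergmanKernel.unique {B₁ B₂ : Para m → Para m → Cl m} (h₁ : IsBergmanKernel m a B₁)
    (h₂ : IsBergmanKernel m a B₂) {w x : Para m} (hw : w ∈ strip m a) (hx : x ∈ strip m a) :
    B₁ w x = B₂ w x := by
  rw [h₁.eq_conj h₂ hw hx, ← h₂.eq_conj h₂ hw hx]

theorem summable_two : Summable fun n : ℤ => (1 + |(n : ℝ)|) ^ (-(2 : ℝ)) :=
  summable_one_add_abs_int_rpow (by norm_num)

theorem inv_pow_le_mul_rpow_neg_two {k : ℝ} (hk : 0 ≤ k) : ((1 + k) ^ 2)⁻¹ = (1 + k) ^ (-(2 : ℝ)) := by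
  rw [Real.rpow_neg (by positivity)]; norm_cast

/-- When |w̲ - x̲| ≥ 1 the distance ρ to an image is at least |w̲ - x̲| and at least a multiple of 1
+ |n| depending only on a, even at the boundary. Of the m + 1 powers of ρ, two pay for the sum over
n and m - 1 are left for |w̲ - x̲|. -/
theorem norm_stripKernel_le_of_one_le (hm : 1 ≤ m) (ha : 0 < a) :
    ∃ M : ℝ, 0 < M ∧ ∀ w ∈ strip m a, ∀ x ∈ strip m a, 1 ≤ ‖w.2 - x.2‖ →
      ‖stripKernel a w x‖ ≤ M / ‖w.2 - x.2‖ ^ (((m : ℝ) - 1) / 2) := by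
  have hm' : (1 : ℝ) ≤ m := by exact_mod_cast hm
  obtain ⟨k, rfl⟩ : ∃ k, m = k + 1 := ⟨m - 1, by omega⟩
  set d := min 1 (2 * a) with hd
  have hd0 : 0 < d := lt_min one_pos (by linarith)
  set Z := ∑' n : ℤ, (1 + |(n : ℝ)|) ^ (-(2 : ℝ)) with hZ
  have hZ0 : 0 ≤ Z := tsum_nonneg fun n => by positivity
  have hσ := sigma_pos (k + 1)
  set D : ℝ := (1 + ((k + 1 : ℕ) + 1) ^ 2) * ((d / 3) ^ 2)⁻¹ with hD
  have hD0 : 0 < D := by positivity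
  refine ⟨‖-2 / sigma (k + 1)‖ * D * Z + 1, by positivity, fun w hw x hx hr => ?_⟩
  set r := ‖w.2 - x.2‖ with hr'
  have hr0 : 0 < r := by linarith
  have hs : |w.1 + x.1| ≤ 2 * a := by
    have := abs_fst_add_le (x := x) hw
    have : |x.1| < a := hx
    linarith
  have hterm : ∀ n : ℤ, ‖cauchyDer (imagePt a x n w)‖ ≤
      D / r ^ ((((k + 1 : ℕ) : ℝ) - 1) / 2) * (1 + |(n : ℝ)|) ^ (-(2 : ℝ)) := fun n => by
    have h0 := abs_fst_le_sqrt_sqn (imagePt a x n w)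
    have h1 := norm_snd_le_sqrt_sqn (imagePt a x n w)
    rw [imagePt_fst] at h0
    rw [imagePt_snd, ← hr'] at h1
    have h2 := two_mul_mul_abs_sub_one_le (a := a) (w.1 + x.1) n hs
    set ρ := √(sqn (imagePt a x n w))
    have h3 : d / 3 * (1 + |(n : ℝ)|) ≤ ρ := by
      refine mul_one_add_div_three_le ((min_le_left _ _).trans (hr.trans h1)) ?_
      rcases le_total (|(n : ℝ)|) 1 with h | h
      · nlinarith
      · have := min_le_right 1 (2 * a)
        nlinarith
    -- Half of the available exponent k = m - 1 is given away, which is allowed because r ≥ 1.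
    have h4 : r ^ ((((k + 1 : ℕ) : ℝ) - 1) / 2) ≤ ρ ^ k := by
      calc _ ≤ r ^ (k : ℝ) := by
            refine Real.rpow_le_rpow_of_exponent_le hr ?_
            push_cast; linarith [(Nat.cast_nonneg k : (0 : ℝ) ≤ k)]
        _ ≤ ρ ^ k := by rw [Real.rpow_natCast]; gcongr
    have hρ : 0 < ρ := hr0.trans_le h1
    refine (norm_cauchyDer_le _).trans ?_
    rw [show k + 1 + 1 = k + 2 from rfl, pow_add, mul_inv, ← inv_pow_le_mul_rpow_neg_two (abs_nonneg _)]
    calc _ ≤ (1 + (((k + 1 : ℕ) : ℝ) + 1) ^ 2) * ((r ^ ((((k + 1 : ℕ) : ℝ) - 1) / 2))⁻¹ *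
          ((d / 3 * (1 + |(n : ℝ)|)) ^ 2)⁻¹) := by gcongr
      _ = _ := by rw [hD]; field_simp
  rw [stripKernel, norm_smul]
  have := tsum_of_norm_bounded (summable_two.mul_left _).hasSum hterm
  rw [tsum_mul_left, ← hZ] at this
  have hrp : 0 < r ^ ((((k + 1 : ℕ) : ℝ) - 1) / 2) := Real.rpow_pos_of_pos hr0 _
  calc _ ≤ ‖-2 / sigma (k + 1)‖ * _ := mul_le_mul_of_nonneg_left this (norm_nonneg _)
    _ = (‖-2 / sigma (k + 1)‖ * D * Z) / r ^ ((((k + 1 : ℕ) : ℝ) - 1) / 2) := by ring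
    _ ≤ _ := by gcongr; linarith

theorem norm_stripKernel_le_rpow (hm : 1 ≤ m) (ha : 0 < a) (p : ℝ) (hp : 0 ≤ p) :
    ∃ M : ℝ, 0 < M ∧ ∀ w ∈ strip m a, ∀ x ∈ strip m a, 1 ≤ ‖w.2 - x.2‖ →
      ‖stripKernel a w x‖ ≤
        M / (‖w.2 - x.2‖ ^ (((m : ℝ) - 1) / 2) * (2 * a - |w.1 + x.1|) ^ p) := by
  obtain ⟨M, hM, h⟩ := norm_stripKernel_le_of_one_le hm ha
  refine ⟨M * (2 * a) ^ p, by positivity, fun w hw x hx hr => (h w hw x hx hr).trans ?_⟩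
  have hs : 0 < 2 * a - |w.1 + x.1| := by
    have := abs_fst_add_le (x := x) hw
    have : |x.1| < a := hx
    linarith
  have h1 : (2 * a - |w.1 + x.1|) ^ p ≤ (2 * a) ^ p :=
    Real.rpow_le_rpow hs.le (by linarith [abs_nonneg (w.1 + x.1)]) hp
  have h2 : 0 < (2 * a - |w.1 + x.1|) ^ p := Real.rpow_pos_of_pos hs p
  have h3 : 0 < ‖w.2 - x.2‖ ^ (((m : ℝ) - 1) / 2) := Real.rpow_pos_of_pos (by linarith) _
  rw [div_le_div_iff₀ h3 (by positivity)]
  calc _ = M * ‖w.2 - x.2‖ ^ (((m : ℝ) - 1) / 2) * (2 * a - |w.1 + x.1|) ^ p := by ring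
    _ ≤ M * ‖w.2 - x.2‖ ^ (((m : ℝ) - 1) / 2) * (2 * a) ^ p := by gcongr
    _ = _ := by ring

/-- On the real axis E is sgn(t)|t|^(-m), whose derivative is a negative scalar; this is why
diagonal values are real. -/
theorem cauchyDer_of_snd_eq_zero {v : Para m} (h : v.2 = 0) (h1 : v.1 ≠ 0) :
    cauchyDer v = (-(m * (|v.1| ^ (m + 1))⁻¹) : ℝ) • (1 : Cl m) := by
  have hs : √(sqn v) = |v.1| := by simp [sqn, h, Real.sqrt_sq_eq_abs]
  have e1 : (sqn v + 0) ^ (-hexp m) = (|v.1| ^ (m + 1))⁻¹ := by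
    rw [← hs, ← sqn_rpow_eq]; congr 1; push_cast [hexp]; ring
  have e2 : (sqn v + 0) ^ (-(hexp m + 1)) = (|v.1| ^ (m + 3))⁻¹ := by
    rw [← hs, ← sqn_rpow_eq]; congr 1; push_cast [hexp]; ring
  have e3 : (|v.1| ^ (m + 1))⁻¹ = v.1 * v.1 * (|v.1| ^ (m + 3))⁻¹ := by
    rw [← abs_mul_abs_self v.1]
    have := abs_pos.2 h1
    field_simp
    ring
  rw [cauchyDer, e1, e2, paraL_bar, h, map_zero, sub_zero, smul_smul, ← sub_smul, e3]
  congr 1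
  ring

theorem stripKernel_self (hm : 1 ≤ m) {x : Para m} (hx : x ∈ strip m a) :
    stripKernel a x x =
      (2 * m / sigma m * ∑' n : ℤ, (|2 * x.1 + 2 * a * (2 * n + 1)| ^ (m + 1))⁻¹ : ℝ) •
        (1 : Cl m) ∧
    2 * m / sigma m * 2⁻¹ ^ (m + 1) / (a - |x.1|) ^ (m + 1) ≤
      2 * m / sigma m * ∑' n : ℤ, (|2 * x.1 + 2 * a * (2 * n + 1)| ^ (m + 1))⁻¹ ∧
    2 * m / sigma m * ∑' n : ℤ, (|2 * x.1 + 2 * a * (2 * n + 1)| ^ (m + 1))⁻¹ ≤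
      2 * m / sigma m * ((3 / 2) ^ (m + 1) * ∑' n : ℤ, (1 + |(n : ℝ)|) ^ (-(2 : ℝ))) /
        (a - |x.1|) ^ (m + 1) := by
  have hx' : |x.1| < a := hx
  have hδ : 0 < a - |x.1| := by linarith
  have hσ := sigma_pos m
  have hs : |2 * x.1| = 2 * |x.1| := by rw [abs_mul, abs_two]
  have hbound : ∀ n : ℤ, (|2 * x.1 + 2 * a * (2 * n + 1)| ^ (m + 1))⁻¹ ≤
      (3 / 2) ^ (m + 1) / (a - |x.1|) ^ (m + 1) * (1 + |(n : ℝ)|) ^ (-(2 : ℝ)) := fun n => by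
    have h1 := two_mul_sub_abs_le (a := a) (2 * x.1) n (by linarith)
    have h2 := two_mul_mul_abs_sub_one_le (a := a) (2 * x.1) n (by linarith)
    -- The image distance grows linearly in |n| with slope proportional to a - |x_0|, so this factor
    -- comes out of the whole sum.
    have h3 : (2 * (a - |x.1|)) / 3 * (1 + |(n : ℝ)|) ≤ |2 * x.1 + 2 * a * (2 * n + 1)| := by
      refine mul_one_add_div_three_le (by linarith) ?_
      rcases le_total (|(n : ℝ)|) 1 with h | h
      · nlinarith [abs_nonneg (2 * x.1 + 2 * a * (2 * n + 1))]
      · have := abs_nonneg x.1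
        nlinarith
    rw [← inv_pow_le_mul_rpow_neg_two (abs_nonneg _)]
    calc _ ≤ (((2 * (a - |x.1|)) / 3 * (1 + |(n : ℝ)|)) ^ (m + 1))⁻¹ := by gcongr
      _ = (3 / 2) ^ (m + 1) / (a - |x.1|) ^ (m + 1) * ((1 + |(n : ℝ)|) ^ (m + 1))⁻¹ := by
          rw [mul_pow, div_pow, div_pow, mul_pow]; field_simp
      _ ≤ _ := by
          gcongr
          · linarith [abs_nonneg (n : ℝ)]
          · omega
  have hsum : Summable fun n : ℤ => (|2 * x.1 + 2 * a * (2 * n + 1)| ^ (m + 1))⁻¹ :=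
    Summable.of_nonneg_of_le (fun n => by positivity) hbound (summable_two.mul_left _)
  refine ⟨?_, ?_, ?_⟩
  · have hterm : ∀ n : ℤ, cauchyDer (imagePt a x n x) =
        (-m * (|2 * x.1 + 2 * a * (2 * n + 1)| ^ (m + 1))⁻¹ : ℝ) • (1 : Cl m) := fun n => by
      have h1 : (imagePt a x n x).1 = 2 * x.1 + 2 * a * (2 * n + 1) := by rw [imagePt_fst]; ring
      have h2 := two_mul_sub_abs_le (a := a) (2 * x.1) n (by linarith)
      rw [cauchyDer_of_snd_eq_zero (by simp [imagePt_snd]) (by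
        rw [h1]; exact abs_pos.1 (by linarith)), h1, neg_mul]
    rw [stripKernel, tsum_congr hterm, (hsum.mul_left _).tsum_smul_const, tsum_mul_left, smul_smul]
    congr 1; ring
  · rw [mul_div_assoc (2 * m / sigma m)]
    refine mul_le_mul_of_nonneg_left ?_ (by positivity)
    -- The reflection in the nearer boundary plane: n = -1 for x_0 ≥ 0 and n = 0 for x_0 ≤ 0. All
    -- terms being nonnegative, this one bounds the sum from below.
    obtain ⟨n, hn⟩ : ∃ n : ℤ, |2 * x.1 + 2 * a * (2 * n + 1)| = 2 * (a - |x.1|) := by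
      rcases le_total 0 x.1 with h | h
      · refine ⟨-1, ?_⟩
        rw [abs_of_nonneg h] at hδ ⊢
        rw [abs_of_nonpos (by push_cast; linarith)]
        push_cast; ring
      · refine ⟨0, ?_⟩
        rw [abs_of_nonpos h] at hδ ⊢
        rw [abs_of_nonneg (by push_cast; linarith)]
        push_cast; ring
    refine le_trans (le_of_eq ?_) (hsum.le_tsum n fun j _ => inv_nonneg.2 (by positivity))
    rw [hn, mul_pow, mul_inv, inv_pow, div_eq_mul_inv]
  · rw [mul_div_assoc (2 * m / sigma m)]
    refine mul_le_mul_of_nonneg_left ?_ (by positivity)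
    refine (Summable.tsum_le_tsum hbound hsum (summable_two.mul_left _)).trans (le_of_eq ?_)
    rw [tsum_mul_left]; ring

end Bounds

/-! ### Images and translates in Green's formula -/

section Reflection

variable {m : ℕ} {a : ℝ}

/-- The translates `w - x + 4an` at which the Cauchy kernel is evaluated. -/
def transPt (a : ℝ) (x : Para m) (n : ℤ) (w : Para m) : Para m := w + (4 * a * n - x.1, -x.2)

theorem transPt_eq (x : Para m) (n : ℤ) (w : Para m) :
    transPt a x n w = (w.1 - x.1 + 4 * a * n, w.2 - x.2) := by
  refine Prod.ext ?_ ?_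
  · simp [transPt]; ring
  · simp [transPt, sub_eq_add_neg]

theorem imagePt_eq (x : Para m) (n : ℤ) (w : Para m) :
    imagePt a x n w = (w.1 + x.1 + 2 * a * (2 * n + 1), w.2 - x.2) :=
  Prod.ext (imagePt_fst x n w) (imagePt_snd x n w)

theorem transPt_zero (x w : Para m) : transPt a x 0 w = w - x := by
  rw [transPt_eq]; refine Prod.ext ?_ ?_ <;> simp

theorem sqn_transPt_pos {x w : Para m} (hx : x ∈ strip m a) (hw : w ∈ strip m a) {n : ℤ}
    (hn : n ≠ 0) : 0 < sqn (transPt a x n w) := by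
  refine sqn_pos fun h => ?_
  have h1 : w.1 - x.1 + 4 * a * n = 0 := by
    have := congrArg Prod.fst h
    rwa [transPt_eq] at this
  have h2 : |w.1 - x.1| < 2 * a :=
    (abs_sub _ _).trans_lt (by linarith [show |w.1| < a from hw, show |x.1| < a from hx])
  have h3 : |w.1 - x.1| = 4 * a * |(n : ℝ)| := by
    rw [eq_neg_of_add_eq_zero_left h1, abs_neg, abs_mul, abs_of_nonneg]
    linarith [abs_nonneg (w.1 - x.1)]
  have h4 : (1 : ℝ) ≤ |(n : ℝ)| := by exact_mod_cast Int.one_le_abs hn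
  nlinarith [abs_nonneg (w.1 - x.1)]

theorem two_smul_integral_imagePt {f : Para m → Cl m} (hf : LeftMonogenicOn f (strip m a))
    {χ : Para m → ℝ} (hχ : ContDiff ℝ 1 χ) (hc : HasCompactSupport χ)
    (hs : tsupport χ ⊆ strip m a) {x : Para m} (hx : x ∈ strip m a) (n : ℤ) :
    (2 : ℝ) • ∫ w, χ w • (conj (cauchyDer (imagePt a x n w)) * f w) =
      -∫ w, cauchyConj (imagePt a x n w) * gradD m (fderiv ℝ χ w) * f w := by
  rw [← integral_rightD_mul (isOpen_strip m a) hf hχ hc hs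
    (contDiffOn_imagePt (fun v hv => contDiffAt_cauchyConj v hv) hx n), ← integral_smul]
  refine integral_congr_ae (Eventually.of_forall fun w => ?_)
  by_cases hw : w ∈ tsupport χ
  · have e : fderiv ℝ (fun w => cauchyConj (imagePt a x n w)) w =
        fderiv ℝ cauchyConj (imagePt a x n w) := fderiv_comp_add_right _
    simp only [e]
    rw [rightD_cauchyConj _ (by simpa using sqn_imagePt_pos hx (hs hw) n), smul_mul_assoc,
      smul_comm]
  · simp [image_eq_zero_of_notMem_tsupport hw]

/-- For n ≠ 0 the pole lies outside the strip, so the translate is right-monogenic there. These null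
terms serve to balance the reflected kernels on both boundary planes. -/
theorem integral_transPt_eq_zero {f : Para m → Cl m} (hf : LeftMonogenicOn f (strip m a))
    {χ : Para m → ℝ} (hχ : ContDiff ℝ 1 χ) (hc : HasCompactSupport χ)
    (hs : tsupport χ ⊆ strip m a) {x : Para m} (hx : x ∈ strip m a) {n : ℤ} (hn : n ≠ 0) :
    ∫ w, cauchyReg 0 (transPt a x n w) * gradD m (fderiv ℝ χ w) * f w = 0 := by
  have hpos : ∀ w ∈ strip m a, 0 < sqn (transPt a x n w) + 0 := fun w hw => by
    simpa using sqn_transPt_pos hx hw hn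
  have hA : ContDiffOn ℝ 1 (fun w => cauchyReg 0 (transPt a x n w)) (strip m a) := fun w hw =>
    (ContDiffAt.comp (g := cauchyReg 0) (f := transPt a x n) w (contDiffAt_cauchyReg _ _ (hpos w hw))
      (contDiff_id.add contDiff_const).contDiffAt).contDiffWithinAt
  rw [← neg_eq_zero, ← integral_rightD_mul (isOpen_strip m a) hf hχ hc hs hA]
  refine integral_eq_zero_of_ae (Eventually.of_forall fun w => ?_)
  by_cases hw : w ∈ tsupport χ
  · have e : fderiv ℝ (fun w => cauchyReg 0 (transPt a x n w)) w =
        fderiv ℝ (cauchyReg 0) (transPt a x n w) := fderiv_comp_add_right _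
    simp only [e]
    rw [rightD_cauchyReg _ _ (hpos w (hs hw))]
    simp
  · simp [image_eq_zero_of_notMem_tsupport hw]

/-- The partial sums of the difference of the Cauchy kernel and its reflections. -/
def reflSum (a : ℝ) (x : Para m) (N : ℕ) (w : Para m) : Cl m :=
  ∑ n ∈ Finset.Icc (-N : ℤ) N, cauchyReg 0 (transPt a x n w) +
    ∑ n ∈ Finset.Ico (-N : ℤ) N, cauchyConj (imagePt a x n w)

/-- The translate n = 0 gives the Cauchy–Pompeiu term, the other translates give zero, and the
reflected kernels give the partial sums of the Bergman kernel. -/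
theorem sigma_smul_add_eq {f : Para m → Cl m} (hf : LeftMonogenicOn f (strip m a))
    {χ : Para m → ℝ} (hχ : ContDiff ℝ 1 χ) (hc : HasCompactSupport χ)
    (hs : tsupport χ ⊆ strip m a) {x : Para m} (hx : x ∈ strip m a)
    {δ : ℝ} (hδ : 0 < δ) (hδχ : ∀ w, ‖w - x‖ < δ → fderiv ℝ χ w = 0) (N : ℕ) :
    sigma m • (χ x • f x) + (2 : ℝ) • ∫ w, χ w •
        (conj (∑ n ∈ Finset.Ico (-N : ℤ) N, cauchyDer (imagePt a x n w)) * f w) =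
      -∫ w, reflSum a x N w * gradD m (fderiv ℝ χ w) * f w := by
  -- Removing the ball keeps the pole of the translate n = 0 away, and costs nothing since ∇χ
  -- vanishes there.
  set K : Set (Para m) := tsupport χ \ Metric.ball x δ with hKdef
  have hK : IsCompact K := hc.diff Metric.isOpen_ball
  have hK0 : ∀ w ∉ K, fderiv ℝ χ w = 0 := fun w hw => by
    by_cases h : w ∈ tsupport χ
    · refine hδχ w ?_
      rw [← dist_eq_norm]
      by_contra h'
      exact hw ⟨h, h'⟩
    · exact fderiv_eq_zero_of_notMem_tsupport h
  have hfK : ContinuousOn f K := hf.1.continuousOn.mono (Set.sdiff_subset.trans hs)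
  have hE : ∀ n : ℤ, Integrable fun w =>
      cauchyReg 0 (transPt a x n w) * gradD m (fderiv ℝ χ w) * f w := fun n => by
    refine integrable_mul_gradD_mul hχ hK hK0 (fun w hw => ?_) hfK
    have hpos : 0 < sqn (transPt a x n w) := by
      by_cases hn : n = 0
      · subst hn
        rw [transPt_zero]
        refine sqn_pos fun h => hw.2 ?_
        rw [sub_eq_zero.1 h]
        exact Metric.mem_ball_self hδ
      · exact sqn_transPt_pos hx (hs hw.1) hn
    exact (ContinuousAt.comp (g := cauchyReg 0) (f := transPt a x n)
      (contDiffAt_cauchyReg (n := 1) _ _ (by simpa using hpos)).continuousAt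
      (continuous_id.add continuous_const).continuousAt).continuousWithinAt
  have hG : ∀ n : ℤ, Integrable fun w =>
      cauchyConj (imagePt a x n w) * gradD m (fderiv ℝ χ w) * f w := fun n =>
    integrable_mul_gradD_mul hχ hK hK0
      ((contDiffOn_imagePt (fun v hv => contDiffAt_cauchyConj v hv) hx n).continuousOn.mono
        (Set.sdiff_subset.trans hs)) hfK
  have hL : ∀ n : ℤ, Integrable fun w => χ w • (conj (cauchyDer (imagePt a x n w)) * f w) :=
    fun n => by
      refine integrable_of_continuousOn_of_eq_zero hc ?_ fun w hw => by
        simp [image_eq_zero_of_notMem_tsupport hw]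
      exact hχ.continuous.continuousOn.smul (continuousOn_mul ((conjL m).continuous.comp_continuousOn
        ((contDiffOn_imagePt (fun v hv => contDiffAt_cauchyDer v hv) hx n).continuousOn.mono hs))
        (hf.1.continuousOn.mono hs))
  have e1 : ∀ w, χ w • (conj (∑ n ∈ Finset.Ico (-N : ℤ) N, cauchyDer (imagePt a x n w)) * f w) =
      ∑ n ∈ Finset.Ico (-N : ℤ) N, χ w • (conj (cauchyDer (imagePt a x n w)) * f w) := fun w => by
    rw [← conjL_apply, map_sum, Finset.sum_mul, Finset.smul_sum]; rfl
  have e2 : ∀ w, reflSum a x N w * gradD m (fderiv ℝ χ w) * f w =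
      ∑ n ∈ Finset.Icc (-N : ℤ) N,
        cauchyReg 0 (transPt a x n w) * gradD m (fderiv ℝ χ w) * f w +
      ∑ n ∈ Finset.Ico (-N : ℤ) N,
        cauchyConj (imagePt a x n w) * gradD m (fderiv ℝ χ w) * f w := fun w => by
    rw [reflSum, add_mul, add_mul, Finset.sum_mul, Finset.sum_mul, Finset.sum_mul, Finset.sum_mul]
  simp_rw [e1, e2]
  rw [integral_finsetSum _ fun n _ => hL n, integral_add (integrable_finsetSum _ fun n _ => hE n)
    (integrable_finsetSum _ fun n _ => hG n), integral_finsetSum _ fun n _ => hE n,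
    integral_finsetSum _ fun n _ => hG n, Finset.smul_sum, neg_add, ← Finset.sum_neg_distrib]
  congr 1
  · rw [Finset.sum_eq_single (0 : ℤ) (fun n _ hn => by
      rw [integral_transPt_eq_zero hf hχ hc hs hx hn, neg_zero])
      (fun h => by simp at h)]
    simp_rw [transPt_zero]
    exact sigma_smul_eq_integral (isOpen_strip m a) hf hχ hc hs hδ hδχ
  · rw [← Finset.sum_neg_distrib]
    exact Finset.sum_congr rfl fun n _ => two_smul_integral_imagePt hf hχ hc hs hx n

/-- This turns the sum of translates and reflections into differences of values of E that differ
only in the real coordinate. -/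
theorem cauchyConj_eq_neg (t : ℝ) (y : EuclideanSpace ℝ (Fin m)) :
    cauchyConj ((t, y) : Para m) = -cauchyReg 0 (-t, y) := by
  rw [cauchyConj, cauchyReg, paraL_bar, paraL_apply]
  simp only [sqn, neg_sq]
  module

theorem norm_cauchyReg_sub_le {y : EuclideanSpace ℝ (Fin m)} {t₁ t₂ D : ℝ}
    (hpos : ∀ t ∈ Set.uIcc t₁ t₂, 0 < sqn ((t, y) : Para m))
    (hD : ∀ t ∈ Set.uIcc t₁ t₂, ‖cauchyDer ((t, y) : Para m)‖ ≤ D) :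
    ‖cauchyReg 0 ((t₁, y) : Para m) - cauchyReg 0 (t₂, y)‖ ≤ D * |t₁ - t₂| := by
  refine Convex.norm_image_sub_le_of_norm_hasDerivWithin_le
    (f := fun t : ℝ => cauchyReg 0 ((t, y) : Para m)) (f' := fun t => cauchyDer ((t, y) : Para m))
    (fun t ht => ?_) hD (convex_uIcc t₁ t₂) Set.right_mem_uIcc Set.left_mem_uIcc
  have hp : 0 < sqn ((t, y) : Para m) + 0 := by simpa using hpos t ht
  rw [← fderiv_cauchyReg_zero_apply _ hp]
  have h1 := (contDiffAt_cauchyReg (n := 1) 0 _ hp).differentiableAt one_ne_zero |>.hasFDerivAt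
  exact (h1.comp_hasDerivAt t ((hasDerivAt_id t).prodMk (hasDerivAt_const t y))).hasDerivWithinAt

end Reflection

/-! ### Cancellation at the boundary of the strip -/

section Estimate

variable {m : ℕ} {a : ℝ}

/-- The mean value inequality along the real axis, with ∂_0 E bounded on the segment. For n ≠ 0 the
segment is automatically far from the pole; only n = 0 needs the alternative in `h2`. -/
theorem norm_cauchyReg_pair_le (hm : 1 ≤ m) {d : ℝ} (hd : 0 < d) (hd1 : d ≤ 1) (hda : d ≤ a)
    {y : EuclideanSpace ℝ (Fin m)} {t₁ t₂ : ℝ} {n : ℤ}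
    (h1 : ∀ t ∈ Set.uIcc t₁ t₂, 4 * a * |(n : ℝ)| - 3 * a ≤ |t|)
    (h2 : n = 0 → (∀ t ∈ Set.uIcc t₁ t₂, d ≤ |t|) ∨ 1 ≤ ‖y‖) :
    ‖cauchyReg 0 ((t₁, y) : Para m) - cauchyReg 0 (t₂, y)‖ ≤
      (1 + (m + 1) ^ 2) * ((d / 3) ^ (m + 1))⁻¹ *
        ((1 + |(n : ℝ)|) ^ (-(5 / 4 : ℝ)) * decay m ‖y‖) * |t₁ - t₂| := by
  have key : ∀ t ∈ Set.uIcc t₁ t₂, d ≤ √(sqn ((t, y) : Para m)) ∧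
      d / 3 * (1 + |(n : ℝ)|) ≤ √(sqn ((t, y) : Para m)) := fun t ht => by
    have k1 : |t| ≤ √(sqn ((t, y) : Para m)) := abs_fst_le_sqrt_sqn ((t, y) : Para m)
    have k2 : ‖y‖ ≤ √(sqn ((t, y) : Para m)) := norm_snd_le_sqrt_sqn ((t, y) : Para m)
    have k3 := h1 t ht
    by_cases hn : n = 0
    · have k4 : d ≤ √(sqn ((t, y) : Para m)) := by
        rcases h2 hn with h | h
        · exact (h t ht).trans k1
        · linarith
      refine ⟨k4, ?_⟩
      subst hn
      simp only [Int.cast_zero, abs_zero]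
      linarith
    · have k5 : (1 : ℝ) ≤ |(n : ℝ)| := by exact_mod_cast Int.one_le_abs hn
      have k6 : d ≤ √(sqn ((t, y) : Para m)) := by nlinarith
      exact ⟨k6, mul_one_add_div_three_le k6 (by nlinarith)⟩
  refine norm_cauchyReg_sub_le (fun t ht => Real.sqrt_pos.1 (hd.trans_le (key t ht).1))
    fun t ht => (norm_cauchyDer_le _).trans ?_
  have k2 : ‖y‖ ≤ √(sqn ((t, y) : Para m)) := norm_snd_le_sqrt_sqn ((t, y) : Para m)
  have k3 : d / 3 * (1 + ‖y‖) ≤ √(sqn ((t, y) : Para m)) := by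
    have := (key t ht).1
    nlinarith [norm_nonneg y]
  have := inv_pow_le_mul_decay hm (by positivity : 0 < d / 3) (abs_nonneg (n : ℝ)) (norm_nonneg y)
    (key t ht).2 k3
  rw [mul_assoc]
  exact mul_le_mul_of_nonneg_left this (by positivity)

theorem norm_cauchyReg_le_of_le_abs {t l : ℝ} (hl : 0 < l) (h : l ≤ |t|)
    (y : EuclideanSpace ℝ (Fin m)) :
    ‖cauchyReg 0 ((t, y) : Para m)‖ ≤ (m + 1) * (l ^ m)⁻¹ := by
  refine (norm_cauchyReg_zero_le _).trans ?_
  have : l ≤ √(sqn ((t, y) : Para m)) := h.trans (abs_fst_le_sqrt_sqn ((t, y) : Para m))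
  gcongr

theorem four_mul_sub_le_abs {s τ : ℝ} (n : ℤ) (ha : 0 < a) (h : |s| ≤ 3 * a)
    (hτ : τ = s + 4 * a * n) : 4 * a * |(n : ℝ)| - 3 * a ≤ |τ| := by
  have h1 : 4 * a * |(n : ℝ)| = |4 * a * n| := by
    rw [abs_mul, abs_of_pos (by linarith : 0 < 4 * a)]
  have h2 : |4 * a * n| ≤ |τ| + |s| := by
    rw [show 4 * a * n = τ - s by rw [hτ]; ring]; exact abs_sub _ _
  linarith

/-- The cancellation between the Cauchy kernel and its reflections near the boundary. -/
theorem exists_norm_reflSum_le (hm : 1 ≤ m) {x : Para m} {b : ℝ} (hxb : |x.1| < b)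
    (hba : b < a) : ∃ C : ℝ, 0 ≤ C ∧ ∀ w ∈ strip m a, b ≤ |w.1| ∨ 1 ≤ ‖w.2 - x.2‖ →
      ∀ N : ℕ, 1 ≤ N → ‖reflSum a x N w‖ ≤
        C * ((a - |w.1|) * decay m ‖w.2 - x.2‖) + (m + 1) * ((a * N) ^ m)⁻¹ := by
  have ha : 0 < a := by linarith [abs_nonneg x.1]
  have hxa : |x.1| < a := hxb.trans hba
  obtain ⟨hx1, hx2⟩ := abs_lt.1 hxa
  obtain ⟨hx3, hx4⟩ := abs_lt.1 hxb
  set d := min 1 (b - |x.1|) with hd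
  have hd0 : 0 < d := lt_min one_pos (by linarith)
  have hd1 : d ≤ 1 := min_le_left _ _
  have hdb : d ≤ b - |x.1| := min_le_right _ _
  have hx5 := neg_abs_le x.1
  have hx6 := le_abs_self x.1
  have hda : d ≤ a := by linarith [abs_nonneg x.1]
  set D : ℝ := (1 + (m + 1) ^ 2) * ((d / 3) ^ (m + 1))⁻¹ with hD
  have hD0 : 0 ≤ D := by positivity
  set Z := ∑' n : ℤ, (1 + |(n : ℝ)|) ^ (-(5 / 4 : ℝ)) with hZ
  have hZ0 : 0 ≤ Z := tsum_nonneg fun n => by positivity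
  refine ⟨D * Z * 2, by positivity, fun w hw hwb N hN => ?_⟩
  obtain ⟨hw1, hw2⟩ := abs_lt.1 (show |w.1| < a from hw)
  have hN' : (1 : ℝ) ≤ N := by exact_mod_cast hN
  set y := w.2 - x.2 with hy
  have hdec : 0 ≤ decay m ‖y‖ := decay_nonneg (norm_nonneg _)
  -- There are 2N + 1 translates against 2N reflections, so one extreme translate stays unpaired; it
  -- is of size (aN)^(-m).
  have hend : ∀ s : ℝ, |s| ≤ 3 * a → ∀ n : ℤ, |(n : ℝ)| = N →
      ‖cauchyReg 0 ((s + 4 * a * n, y) : Para m)‖ ≤ (m + 1) * ((a * N) ^ m)⁻¹ := fun s hs n hn => by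
    refine norm_cauchyReg_le_of_le_abs (by positivity) ?_ y
    refine le_trans ?_ (four_mul_sub_le_abs n ha hs rfl)
    rw [hn]; nlinarith
  have hfin : ∀ (F : Finset ℤ) (g : ℤ → Cl m), (∀ n ∈ F, ‖g n‖ ≤
      D * ((1 + |(n : ℝ)|) ^ (-(5 / 4 : ℝ)) * decay m ‖y‖) * (2 * (a - |w.1|))) →
      ‖∑ n ∈ F, g n‖ ≤ D * Z * 2 * ((a - |w.1|) * decay m ‖y‖) := fun F g hg => by
    have hpos : 0 ≤ a - |w.1| := sub_nonneg.2 (show |w.1| < a from hw).le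
    calc _ ≤ ∑ n ∈ F, D * ((1 + |(n : ℝ)|) ^ (-(5 / 4 : ℝ)) * decay m ‖y‖) * (2 * (a - |w.1|)) :=
          norm_sum_le_of_le _ hg
      _ = D * 2 * ((a - |w.1|) * decay m ‖y‖) * ∑ n ∈ F, (1 + |(n : ℝ)|) ^ (-(5 / 4 : ℝ)) := by
          rw [Finset.mul_sum]; exact Finset.sum_congr rfl fun n _ => by ring
      _ ≤ D * 2 * ((a - |w.1|) * decay m ‖y‖) * Z := by
          refine mul_le_mul_of_nonneg_left ?_ (by positivity)
          exact summable_five_fourths.sum_le_tsum F fun n _ => by positivity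
      _ = _ := by ring
  rw [reflSum]
  simp only [transPt_eq, imagePt_eq, cauchyConj_eq_neg, ← hy, Finset.sum_neg_distrib]
  rcases le_total 0 w.1 with h0 | h0
  · have hr : ∑ n ∈ Finset.Ico (-N : ℤ) N,
        cauchyReg 0 ((-(w.1 + x.1 + 2 * a * (2 * n + 1)), y) : Para m) =
        ∑ n ∈ Finset.Ico (-N : ℤ) N, cauchyReg 0 ((2 * a - w.1 - x.1 + 4 * a * n, y) : Para m) := by
      refine Finset.sum_nbij' (fun n => -n - 1) (fun n => -n - 1) ?_ ?_ ?_ ?_ ?_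
      · intro n hn; simp only [Finset.mem_Ico] at hn ⊢; omega
      · intro n hn; simp only [Finset.mem_Ico] at hn ⊢; omega
      · intro n _; ring
      · intro n _; ring
      · intro n _; push_cast; congr 2; ring
    rw [hr, ← Finset.Ico_insert_right (show (-N : ℤ) ≤ N by omega),
      Finset.sum_insert Finset.right_notMem_Ico, add_assoc, ← sub_eq_add_neg,
      ← Finset.sum_sub_distrib, add_comm]
    refine (norm_add_le _ _).trans (add_le_add (hfin _ _ fun n _ => ?_) ?_)
    · have hab : |w.1| = w.1 := abs_of_nonneg h0
      refine (norm_cauchyReg_pair_le hm hd0 hd1 hda (n := n) ?_ ?_).trans (le_of_eq ?_)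
      · intro t ht
        refine four_mul_sub_le_abs (s := t - 4 * a * n) n ha ?_ (by ring)
        rw [abs_le]
        rcases Set.mem_uIcc.1 ht with h | h <;> constructor <;> linarith [h.1, h.2]
      · intro hn
        subst hn
        refine hwb.imp_left fun hb t ht => le_trans ?_ (le_abs_self t)
        rw [hab] at hb
        push_cast at ht
        rcases Set.mem_uIcc.1 ht with h | h <;> linarith [h.1, h.2]
      · rw [hab, show w.1 - x.1 + 4 * a * n - (2 * a - w.1 - x.1 + 4 * a * n) = -(2 * (a - w.1)) by
          ring, abs_neg, abs_of_nonneg (by linarith : 0 ≤ 2 * (a - w.1))]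
    · exact hend _ (by rw [abs_le]; constructor <;> linarith) N (by simp)
  · have hr : ∑ n ∈ Finset.Ico (-N : ℤ) N,
        cauchyReg 0 ((-(w.1 + x.1 + 2 * a * (2 * n + 1)), y) : Para m) =
        ∑ n ∈ Finset.Ioc (-N : ℤ) N,
          cauchyReg 0 ((-(2 * a) - w.1 - x.1 + 4 * a * n, y) : Para m) := by
      refine Finset.sum_nbij' (fun n => -n) (fun n => -n) ?_ ?_ ?_ ?_ ?_
      · intro n hn; simp only [Finset.mem_Ico, Finset.mem_Ioc] at hn ⊢; omega
      · intro n hn; simp only [Finset.mem_Ico, Finset.mem_Ioc] at hn ⊢; omega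
      · intro n _; ring
      · intro n _; ring
      · intro n _; push_cast; congr 2; ring
    rw [hr, ← Finset.Ioc_insert_left (show (-N : ℤ) ≤ N by omega),
      Finset.sum_insert Finset.left_notMem_Ioc, add_assoc, ← sub_eq_add_neg,
      ← Finset.sum_sub_distrib, add_comm]
    refine (norm_add_le _ _).trans (add_le_add (hfin _ _ fun n _ => ?_) ?_)
    · have hab : |w.1| = -w.1 := abs_of_nonpos h0
      refine (norm_cauchyReg_pair_le hm hd0 hd1 hda (n := n) ?_ ?_).trans (le_of_eq ?_)
      · intro t ht
        refine four_mul_sub_le_abs (s := t - 4 * a * n) n ha ?_ (by ring)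
        rw [abs_le]
        rcases Set.mem_uIcc.1 ht with h | h <;> constructor <;> linarith [h.1, h.2]
      · intro hn
        subst hn
        refine hwb.imp_left fun hb t ht => le_trans ?_ (neg_le_abs t)
        rw [hab] at hb
        push_cast at ht
        rcases Set.mem_uIcc.1 ht with h | h <;> linarith [h.1, h.2]
      · rw [hab, show w.1 - x.1 + 4 * a * n - (-(2 * a) - w.1 - x.1 + 4 * a * n) =
          2 * (a - -w.1) by ring, abs_of_nonneg (by linarith : 0 ≤ 2 * (a - -w.1))]
    · exact hend _ (by rw [abs_le]; constructor <;> linarith) _ (by simp)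

end Estimate

/-! ### The reproducing formula with a cutoff error -/

section Limit

variable {m : ℕ} {a : ℝ}

theorem tendsto_sum_Ico_neg {M : Type*} [AddCommMonoid M] [TopologicalSpace M] {g : ℤ → M}
    (hg : Summable g) :
    Tendsto (fun N : ℕ => ∑ n ∈ Finset.Ico (-N : ℤ) N, g n) atTop (𝓝 (∑' n, g n)) := by
  refine hg.hasSum.comp (tendsto_atTop_finset_of_monotone (fun N M h => ?_) fun n => ?_)
  · exact Finset.Ico_subset_Ico (by omega) (by omega)
  · exact ⟨n.natAbs + 1, by simp only [Finset.mem_Ico]; omega⟩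

theorem tendsto_integral_partialSum (hm : 1 ≤ m) {f : Para m → Cl m}
    (hf : LeftMonogenicOn f (strip m a))
    {χ : Para m → ℝ} (hχ : ContDiff ℝ 1 χ) (hc : HasCompactSupport χ)
    (hs : tsupport χ ⊆ strip m a) {x : Para m} (hx : x ∈ strip m a) :
    Tendsto (fun N : ℕ => ∫ w, χ w •
        (conj (∑ n ∈ Finset.Ico (-N : ℤ) N, cauchyDer (imagePt a x n w)) * f w)) atTop
      (𝓝 (∫ w, χ w • (conj (∑' n, cauchyDer (imagePt a x n w)) * f w))) := by
  obtain ⟨C, hC, h⟩ := norm_cauchyDer_imagePt_le hm hx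
  set Z := ∑' n : ℤ, (1 + |(n : ℝ)|) ^ (-(5 / 4 : ℝ))
  have hfc : ContinuousOn f (tsupport χ) := hf.1.continuousOn.mono hs
  refine tendsto_integral_of_dominated_convergence
    (fun w => ‖mulL m‖ * (C * Z) * (‖χ w‖ * ‖f w‖)) (fun N => ?_) ?_ (fun N => ?_) ?_
  · refine Integrable.aestronglyMeasurable (integrable_of_continuousOn_of_eq_zero hc ?_ fun w hw =>
      by simp [image_eq_zero_of_notMem_tsupport hw])
    exact hχ.continuous.continuousOn.smul (continuousOn_mul ((conjL m).continuous.comp_continuousOn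
      (continuousOn_finsetSum _ fun n _ =>
        (contDiffOn_imagePt (fun v hv => contDiffAt_cauchyDer v hv) hx n).continuousOn.mono hs)) hfc)
  · refine Integrable.const_mul (integrable_of_continuousOn_of_eq_zero hc ?_ fun w hw =>
      by simp [image_eq_zero_of_notMem_tsupport hw]) _
    exact hχ.continuous.norm.continuousOn.mul hfc.norm
  · refine Eventually.of_forall fun w => ?_
    by_cases hw : w ∈ tsupport χ
    · have hd := decay_le_one hm (norm_nonneg (w.2 - x.2))
      have hd' := decay_nonneg (m := m) (norm_nonneg (w.2 - x.2))
      have hsum : ‖∑ n ∈ Finset.Ico (-N : ℤ) N, cauchyDer (imagePt a x n w)‖ ≤ C * Z := by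
        refine (norm_sum_le_of_le _ fun n _ => h w (hs hw) n).trans ?_
        rw [← Finset.mul_sum]
        refine mul_le_mul (by nlinarith) ?_ (Finset.sum_nonneg fun n _ => by positivity) hC
        exact summable_five_fourths.sum_le_tsum _ fun n _ => by positivity
      rw [norm_smul]
      calc _ ≤ ‖χ w‖ * (‖mulL m‖ * ‖conj (∑ n ∈ Finset.Ico (-N : ℤ) N,
            cauchyDer (imagePt a x n w))‖ * ‖f w‖) := by gcongr; exact norm_mul_le_mulL _ _
        _ ≤ ‖χ w‖ * (‖mulL m‖ * (C * Z) * ‖f w‖) := by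
            rw [norm_conj]; gcongr
        _ = _ := by ring
    · simp [image_eq_zero_of_notMem_tsupport hw]
  · refine Eventually.of_forall fun w => ?_
    by_cases hw : w ∈ tsupport χ
    · have h1 := tendsto_sum_Ico_neg (summable_cauchyDer_imagePt hm hx (hs hw))
      have h2 : Continuous fun z : Cl m => χ w • (conj z * f w) :=
        ((χ w) • ((mulL m).flip (f w)).comp (conjL m : Cl m →L[ℝ] Cl m)).continuous
      exact (h2.tendsto _).comp h1
    · simp [image_eq_zero_of_notMem_tsupport hw]

theorem conj_stripKernel (w x : Para m) :
    conj (stripKernel a w x) = (-2 / sigma m) • conj (∑' n, cauchyDer (imagePt a x n w)) := by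
  rw [stripKernel, ← conjL_apply, map_smul]; rfl

/-- The error in the reproducing formula made by a cutoff function. -/
theorem exists_norm_sub_integral_le (hm : 1 ≤ m) {x : Para m} {b : ℝ} (hxb : |x.1| < b)
    (hba : b < a) : ∃ C : ℝ, ∀ f : Para m → Cl m, LeftMonogenicOn f (strip m a) →
      ∀ χ : Para m → ℝ, ContDiff ℝ 1 χ → HasCompactSupport χ → tsupport χ ⊆ strip m a →
      (∀ w, |w.1| < b → ‖w.2 - x.2‖ < 1 → fderiv ℝ χ w = 0) →
      ‖χ x • f x - ∫ w in strip m a, χ w • (conj (stripKernel a w x) * f w)‖ ≤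
        C * ∫ w in strip m a, (a - |w.1|) * decay m ‖w.2 - x.2‖ * (‖gradD m (fderiv ℝ χ w)‖ * ‖f w‖) := by
  have ha : 0 < a := by linarith [abs_nonneg x.1]
  have hx : x ∈ strip m a := hxb.trans hba
  have hσ := sigma_pos m
  obtain ⟨C, hC, h⟩ := exists_norm_reflSum_le hm hxb hba
  refine ⟨(sigma m)⁻¹ * (‖mulL m‖ ^ 2 * C), fun f hf χ hχ hc hs h0 => ?_⟩
  have hfc : ContinuousOn f (tsupport χ) := hf.1.continuousOn.mono hs
  have hδχ : ∀ w, ‖w - x‖ < min 1 (b - |x.1|) → fderiv ℝ χ w = 0 := fun w hw => by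
    have h1 : |w.1 - x.1| ≤ ‖w - x‖ := norm_fst_le (w - x)
    have h2 : ‖w.2 - x.2‖ ≤ ‖w - x‖ := norm_snd_le (w - x)
    refine h0 w ?_ (h2.trans_lt (hw.trans_le (min_le_left _ _)))
    have h3 := abs_sub_abs_le_abs_sub w.1 x.1
    linarith [hw.trans_le (min_le_right _ _)]
  have hδ : 0 < min 1 (b - |x.1|) := lt_min one_pos (by linarith)
  set Q : Para m → ℝ := fun w =>
    (a - |w.1|) * decay m ‖w.2 - x.2‖ * (‖gradD m (fderiv ℝ χ w)‖ * ‖f w‖) with hQ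
  set P : Para m → ℝ := fun w => 1 * (‖gradD m (fderiv ℝ χ w)‖ * ‖f w‖) with hP
  have hQi : Integrable Q := integrable_mul_norm_gradD_mul hχ hc hfc
    ((by fun_prop : Continuous fun w : Para m => a - |w.1|).mul (continuous_decay x.2))
  have hPi : Integrable P := integrable_mul_norm_gradD_mul hχ hc hfc continuous_const
  -- Where ∇χ ≠ 0 the point is near the boundary or far from x, so the cancellation estimate
  -- applies. The unpaired translate gives the second term, which disappears as N → ∞ because m ≥ 1.
  have hN : ∀ N : ℕ, 1 ≤ N → ‖sigma m • (χ x • f x) + (2 : ℝ) • ∫ w, χ w •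
        (conj (∑ n ∈ Finset.Ico (-N : ℤ) N, cauchyDer (imagePt a x n w)) * f w)‖ ≤
      (‖mulL m‖ ^ 2 * C * ∫ w, Q w) + ‖mulL m‖ ^ 2 * ((m + 1) * ((a * N) ^ m)⁻¹) * ∫ w, P w :=
    fun N hN1 => by
      rw [sigma_smul_add_eq hf hχ hc hs hx hδ hδχ N, norm_neg, ← integral_const_mul,
        ← integral_const_mul, ← integral_add (hQi.const_mul _) (hPi.const_mul _)]
      refine norm_integral_le_of_norm_le ((hQi.const_mul _).add (hPi.const_mul _))
        (Eventually.of_forall fun w => ?_)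
      by_cases hw : w ∈ tsupport χ
      · by_cases hw' : |w.1| < b ∧ ‖w.2 - x.2‖ < 1
        · simp [hQ, hP, h0 w hw'.1 hw'.2]
        · have hw'' : b ≤ |w.1| ∨ 1 ≤ ‖w.2 - x.2‖ := by
            by_contra! hcon; exact hw' hcon
          refine (norm_mul_mul_le _ _ _).trans ?_
          calc _ ≤ ‖mulL m‖ ^ 2 * (C * ((a - |w.1|) * decay m ‖w.2 - x.2‖) +
                (m + 1) * ((a * N) ^ m)⁻¹) * ‖gradD m (fderiv ℝ χ w)‖ * ‖f w‖ := by
                gcongr; exact h w (hs hw) hw'' N hN1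
            _ = _ := by simp only [hQ, hP]; ring
      · simp [hQ, hP, fderiv_eq_zero_of_notMem_tsupport hw]
  have lim1 := ((tendsto_integral_partialSum hm hf hχ hc hs hx).const_smul (2 : ℝ)).const_add
    (sigma m • (χ x • f x)) |>.norm
  have t0 : Tendsto (fun N : ℕ => ((a * (N : ℝ)) ^ m)⁻¹) atTop (𝓝 0) :=
    ((tendsto_pow_atTop (by omega)).comp
      (tendsto_natCast_atTop_atTop.const_mul_atTop ha)).inv_tendsto_atTop
  have lim2 := (((t0.const_mul ((m : ℝ) + 1)).const_mul (‖mulL m‖ ^ 2)).mul_const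
    (∫ w, P w)).const_add (‖mulL m‖ ^ 2 * C * ∫ w, Q w)
  simp only [mul_zero, zero_mul, add_zero] at lim2
  have hle := le_of_tendsto_of_tendsto lim1 lim2
    (by filter_upwards [eventually_ge_atTop 1] with N hN1 using hN N hN1)
  -- Here the normalisation -2/σ of the kernel is forced.
  have e : χ x • f x - ∫ w, χ w • (conj (stripKernel a w x) * f w) =
      (sigma m)⁻¹ • (sigma m • (χ x • f x) +
        (2 : ℝ) • ∫ w, χ w • (conj (∑' n, cauchyDer (imagePt a x n w)) * f w)) := by
    rw [smul_add, inv_smul_smul₀ hσ.ne', smul_smul, ← integral_smul, sub_eq_add_neg,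
      ← integral_neg]
    congr 2
    funext w
    rw [conj_stripKernel, smul_mul_assoc, smul_comm, ← neg_smul]
    congr 1
    field_simp
  have hS1 : ∫ w in strip m a, χ w • (conj (stripKernel a w x) * f w) =
      ∫ w, χ w • (conj (stripKernel a w x) * f w) :=
    setIntegral_eq_integral_of_forall_compl_eq_zero fun w hw => by
      rw [image_eq_zero_of_notMem_tsupport fun h' => hw (hs h'), zero_smul]
  have hS2 : ∫ w in strip m a, Q w = ∫ w, Q w :=
    setIntegral_eq_integral_of_forall_compl_eq_zero fun w hw => by
      simp [hQ, fderiv_eq_zero_of_notMem_tsupport fun h' => hw (hs h')]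
  rw [hS1, hS2, e, norm_smul, Real.norm_of_nonneg (by positivity), mul_assoc]
  exact mul_le_mul_of_nonneg_left hle (by positivity)

end Limit

/-! ### Cutoff functions of the strip -/

section CutoffFunctions

variable {m : ℕ} {a : ℝ}

theorem deriv_smoothTransition_eq_zero {t : ℝ} (ht : t < 0 ∨ 1 < t) :
    deriv Real.smoothTransition t = 0 := by
  rcases ht with h | h
  · have : Real.smoothTransition =ᶠ[𝓝 t] fun _ => 0 := by
      filter_upwards [Iio_mem_nhds h] with s hs using
        Real.smoothTransition.zero_of_nonpos (le_of_lt hs)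
    rw [this.deriv_eq, deriv_const]
  · have : Real.smoothTransition =ᶠ[𝓝 t] fun _ => 1 := by
      filter_upwards [Ioi_mem_nhds h] with s hs using
        Real.smoothTransition.one_of_one_le (le_of_lt hs)
    rw [this.deriv_eq, deriv_const]

theorem exists_abs_deriv_smoothTransition_le :
    ∃ L : ℝ, 0 ≤ L ∧ ∀ t, |deriv Real.smoothTransition t| ≤ L := by
  have hc : Continuous (deriv Real.smoothTransition) :=
    (Real.smoothTransition.contDiff (n := 1)).continuous_deriv le_rfl
  obtain ⟨L, hL⟩ := isCompact_Icc.exists_bound_of_continuousOn (s := Set.Icc (0 : ℝ) 1)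
    hc.continuousOn
  have hL0 : 0 ≤ L := (norm_nonneg _).trans (hL 0 ⟨le_rfl, zero_le_one⟩)
  refine ⟨L, hL0, fun t => ?_⟩
  by_cases ht : t ∈ Set.Icc (0 : ℝ) 1
  · exact hL t ht
  · rw [deriv_smoothTransition_eq_zero, abs_zero]
    · exact hL0
    · by_contra! h
      exact ht ⟨h.1, h.2⟩

theorem hasFDerivAt_smoothTransition_comp {V : Type*} [NormedAddCommGroup V] [NormedSpace ℝ V]
    {g : V → ℝ} {g' : V →L[ℝ] ℝ} {w : V} (hg : HasFDerivAt g g' w) :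
    HasFDerivAt (fun w => Real.smoothTransition (g w))
      (deriv Real.smoothTransition (g w) • g') w :=
  (((Real.smoothTransition.contDiff (n := 1)).differentiable one_ne_zero _).hasDerivAt).comp_hasFDerivAt
    w hg

/-- A smooth function that cuts off the strip near its boundary and near infinity. -/
def stripCutoff (a J : ℝ) (w : Para m) : ℝ :=
  Real.smoothTransition (J * (a - w.1) - 1) * Real.smoothTransition (J * (a + w.1) - 1) *
    Real.smoothTransition (2 - ‖w.2‖ ^ 2 / J ^ 2)

theorem contDiff_stripCutoff (a J : ℝ) : ContDiff ℝ 1 (stripCutoff a J : Para m → ℝ) := by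
  have h1 : ContDiff ℝ 1 fun w : Para m => J * (a - w.1) - 1 := by fun_prop
  have h2 : ContDiff ℝ 1 fun w : Para m => J * (a + w.1) - 1 := by fun_prop
  have h3 : ContDiff ℝ 1 fun w : Para m => 2 - ‖w.2‖ ^ 2 / J ^ 2 :=
    contDiff_const.sub ((contDiff_snd.norm_sq ℝ).div_const _)
  exact ((Real.smoothTransition.contDiff.comp h1).mul (Real.smoothTransition.contDiff.comp h2)).mul
    (Real.smoothTransition.contDiff.comp h3)

theorem tsupport_stripCutoff_subset {J : ℝ} (hJ : 0 < J) :
    tsupport (stripCutoff a J : Para m → ℝ) ⊆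
      Set.Icc (-(a - J⁻¹)) (a - J⁻¹) ×ˢ Metric.closedBall 0 (2 * J) := by
  refine closure_minimal (fun w hw => ?_) (isClosed_Icc.prod Metric.isClosed_closedBall)
  rw [Function.mem_support, stripCutoff, mul_ne_zero_iff, mul_ne_zero_iff] at hw
  obtain ⟨⟨h1, h2⟩, h3⟩ := hw
  have k : ∀ t : ℝ, Real.smoothTransition t ≠ 0 → 0 < t := fun t ht => by
    by_contra! h
    exact ht (Real.smoothTransition.zero_of_nonpos h)
  have k1 := k _ h1
  have k2 := k _ h2
  have k3 := k _ h3
  have l1 : J⁻¹ < a - w.1 := by rw [inv_lt_iff_one_lt_mul₀ hJ]; linarith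
  have l2 : J⁻¹ < a + w.1 := by rw [inv_lt_iff_one_lt_mul₀ hJ]; linarith
  refine ⟨⟨by linarith, by linarith⟩, ?_⟩
  rw [mem_closedBall_zero_iff]
  rw [sub_pos, div_lt_iff₀ (by positivity)] at k3
  exact abs_le_of_sq_le_sq' (by nlinarith) (by positivity) |>.2

theorem hasCompactSupport_stripCutoff {J : ℝ} (hJ : 0 < J) :
    HasCompactSupport (stripCutoff a J : Para m → ℝ) :=
  (isCompact_Icc.prod (isCompact_closedBall _ _)).of_isClosed_subset (isClosed_tsupport _)
    (tsupport_stripCutoff_subset hJ)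

theorem tsupport_stripCutoff_subset_strip {J : ℝ} (hJ : 0 < J) :
    tsupport (stripCutoff a J : Para m → ℝ) ⊆ strip m a := fun w hw => by
  have h := Set.mem_Icc.1 (tsupport_stripCutoff_subset hJ hw).1
  have : 0 < J⁻¹ := by positivity
  change |w.1| < a
  rw [abs_lt]
  constructor <;> linarith [h.1, h.2]

theorem abs_stripCutoff_le_one (J : ℝ) (w : Para m) : |stripCutoff a J w| ≤ 1 := by
  have k0 := Real.smoothTransition.nonneg
  have k1 := Real.smoothTransition.le_one
  rw [stripCutoff, abs_of_nonneg (mul_nonneg (mul_nonneg (k0 _) (k0 _)) (k0 _))]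
  exact mul_le_one₀ (mul_le_one₀ (k1 _) (k0 _) (k1 _)) (k0 _) (k1 _)

theorem stripCutoff_eq_one {J b R : ℝ} (hJ : 0 < J) (hb : 2 ≤ J * (a - b)) (hR : R ≤ J)
    {w : Para m} (h1 : |w.1| ≤ b) (h2 : ‖w.2‖ ≤ R) : stripCutoff a J w = 1 := by
  have k1 := le_abs_self w.1
  have k2 := neg_abs_le w.1
  rw [stripCutoff, Real.smoothTransition.one_of_one_le, Real.smoothTransition.one_of_one_le,
    Real.smoothTransition.one_of_one_le, one_mul, one_mul]
  · have : ‖w.2‖ ^ 2 / J ^ 2 ≤ 1 := by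
      rw [div_le_one (by positivity)]
      exact pow_le_pow_left₀ (norm_nonneg _) (h2.trans hR) 2
    linarith
  · nlinarith
  · nlinarith

theorem fderiv_stripCutoff_eq_zero {J b R : ℝ} (hJ : 0 < J) (hb : 2 ≤ J * (a - b)) (hR : R ≤ J)
    {w : Para m} (h1 : |w.1| < b) (h2 : ‖w.2‖ < R) : fderiv ℝ (stripCutoff a J) w = 0 := by
  have h : stripCutoff a J =ᶠ[𝓝 w] fun _ : Para m => (1 : ℝ) := by
    have o1 : ∀ᶠ v : Para m in 𝓝 w, |v.1| < b :=
      (continuous_abs.comp continuous_fst).continuousAt.eventually_lt_const h1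
    have o2 : ∀ᶠ v : Para m in 𝓝 w, ‖v.2‖ < R :=
      (continuous_norm.comp continuous_snd).continuousAt.eventually_lt_const h2
    filter_upwards [o1, o2] with v hv1 hv2 using stripCutoff_eq_one hJ hb hR hv1.le hv2.le
  rw [h.fderiv_eq]
  exact (hasFDerivAt_const (1 : ℝ) w).fderiv

/-- The normal derivative is of order J but lives where a - |w_0| ≤ 2/J; the tangential one is of
order 1/J. So the weighted gradient is bounded uniformly in J. -/
theorem exists_mul_norm_fderiv_stripCutoff_le (m : ℕ) (ha : 0 < a) :
    ∃ C : ℝ, 0 ≤ C ∧ ∀ J : ℝ, 1 ≤ J → ∀ w : Para m, w ∈ strip m a →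
      (a - |w.1|) * ‖gradD m (fderiv ℝ (stripCutoff a J) w)‖ ≤ C := by
  obtain ⟨L, hL0, hL⟩ := exists_abs_deriv_smoothTransition_le
  refine ⟨‖gradD m‖ * (2 * L + 2 * L + a * (4 * L)), by positivity, fun J hJ w hw => ?_⟩
  have hJ0 : 0 < J := by linarith
  have hw' : 0 ≤ a - |w.1| := sub_nonneg.2 (show |w.1| < a from hw).le
  have hf : HasFDerivAt (fun w : Para m => w.1) (ContinuousLinearMap.fst ℝ _ _) w := hasFDerivAt_fst
  have hs : HasFDerivAt (fun w : Para m => ‖w.2‖ ^ 2) _ w :=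
    (hasFDerivAt_snd (𝕜 := ℝ) (p := w)).norm_sq
  have d1 : HasFDerivAt (fun w : Para m => Real.smoothTransition (J * (a - w.1) - 1))
      ((deriv Real.smoothTransition (J * (a - w.1) - 1) * -J) •
        ContinuousLinearMap.fst ℝ ℝ (EuclideanSpace ℝ (Fin m))) w :=
    (hasFDerivAt_smoothTransition_comp (((hf.const_sub a).const_mul J).sub_const 1)).congr_fderiv
      (by module)
  have d2 : HasFDerivAt (fun w : Para m => Real.smoothTransition (J * (a + w.1) - 1))
      ((deriv Real.smoothTransition (J * (a + w.1) - 1) * J) •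
        ContinuousLinearMap.fst ℝ ℝ (EuclideanSpace ℝ (Fin m))) w :=
    (hasFDerivAt_smoothTransition_comp (((hf.const_add a).const_mul J).sub_const 1)).congr_fderiv
      (by module)
  have d3 : HasFDerivAt (fun w : Para m => Real.smoothTransition (2 - ‖w.2‖ ^ 2 / J ^ 2))
      ((deriv Real.smoothTransition (2 - ‖w.2‖ ^ 2 / J ^ 2) * -((J ^ 2)⁻¹ * 2)) •
        (innerSL ℝ w.2).comp (ContinuousLinearMap.snd ℝ ℝ (EuclideanSpace ℝ (Fin m)))) w :=
    (hasFDerivAt_smoothTransition_comp ((hs.mul_const (J ^ 2)⁻¹).const_sub 2)).congr_fderiv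
      (by rw [← div_eq_mul_inv]; module)
  have k0 := Real.smoothTransition.nonneg
  have k1 := Real.smoothTransition.le_one
  have hfst : ‖ContinuousLinearMap.fst ℝ ℝ (EuclideanSpace ℝ (Fin m))‖ ≤ 1 :=
    ContinuousLinearMap.norm_fst_le ..
  have hsnd : ‖ContinuousLinearMap.snd ℝ ℝ (EuclideanSpace ℝ (Fin m))‖ ≤ 1 :=
    ContinuousLinearMap.norm_snd_le ..
  -- Used with s = a - w_0 and s = a + w_0. The derivative is nonzero only for 0 ≤ t ≤ 1, that is
  -- for 1 ≤ Js ≤ 2.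
  have n1 : ∀ t s : ℝ, (a - |w.1|) ≤ s → t = J * s - 1 →
      (a - |w.1|) * (|deriv Real.smoothTransition t| * J) ≤ 2 * L := fun t s h1 h2 => by
    by_cases ht : t < 0 ∨ 1 < t
    · rw [deriv_smoothTransition_eq_zero ht]; simp; positivity
    · push Not at ht
      have : (a - |w.1|) * J ≤ 2 := by nlinarith
      nlinarith [hL t, abs_nonneg (deriv Real.smoothTransition t)]
  have n2 : |deriv Real.smoothTransition (2 - ‖w.2‖ ^ 2 / J ^ 2)| * ((J ^ 2)⁻¹ * 2) * ‖w.2‖ ≤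
      4 * L := by
    by_cases ht : 2 - ‖w.2‖ ^ 2 / J ^ 2 < 0 ∨ 1 < 2 - ‖w.2‖ ^ 2 / J ^ 2
    · rw [deriv_smoothTransition_eq_zero ht]; simp; positivity
    · push Not at ht
      have h1 : ‖w.2‖ ^ 2 ≤ 2 * J ^ 2 := by
        rw [← div_le_iff₀ (by positivity)]; linarith
      have h2 : ‖w.2‖ ≤ 2 * J := (abs_le_of_sq_le_sq' (by nlinarith) (by positivity)).2
      calc _ ≤ L * ((J ^ 2)⁻¹ * 2) * (2 * J) := by gcongr; exact hL _
        _ = 4 * L * J⁻¹ := by field_simp; ring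
        _ ≤ 4 * L * 1 := by gcongr; exact inv_le_one_of_one_le₀ hJ
        _ = _ := mul_one _
  have hsm : ∀ (t : ℝ) (T : Para m →L[ℝ] ℝ), ‖Real.smoothTransition t • T‖ ≤ ‖T‖ := fun t T => by
    rw [norm_smul, Real.norm_of_nonneg (k0 t)]
    exact mul_le_of_le_one_left (norm_nonneg _) (k1 t)
  have e1 := n1 _ (a - w.1) (by linarith [le_abs_self w.1]) rfl
  have e2 := n1 _ (a + w.1) (by linarith [neg_abs_le w.1]) rfl
  have e3 : (a - |w.1|) * (4 * L) ≤ a * (4 * L) := by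
    gcongr; linarith [abs_nonneg w.1]
  have m1 : ‖(deriv Real.smoothTransition (J * (a - w.1) - 1) * -J) •
        ContinuousLinearMap.fst ℝ ℝ (EuclideanSpace ℝ (Fin m))‖ ≤
      |deriv Real.smoothTransition (J * (a - w.1) - 1)| * J := by
    rw [norm_smul, norm_mul, norm_neg, Real.norm_of_nonneg hJ0.le]
    exact mul_le_of_le_one_right (by positivity) hfst
  have m2 : ‖(deriv Real.smoothTransition (J * (a + w.1) - 1) * J) •
        ContinuousLinearMap.fst ℝ ℝ (EuclideanSpace ℝ (Fin m))‖ ≤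
      |deriv Real.smoothTransition (J * (a + w.1) - 1)| * J := by
    rw [norm_smul, norm_mul, Real.norm_of_nonneg hJ0.le]
    exact mul_le_of_le_one_right (by positivity) hfst
  have m3 : ‖(deriv Real.smoothTransition (2 - ‖w.2‖ ^ 2 / J ^ 2) * -((J ^ 2)⁻¹ * 2)) •
        (innerSL ℝ w.2).comp (ContinuousLinearMap.snd ℝ ℝ (EuclideanSpace ℝ (Fin m)))‖ ≤ 4 * L := by
    refine le_trans ?_ n2
    rw [norm_smul, norm_mul, norm_neg, Real.norm_of_nonneg (by positivity : 0 ≤ (J ^ 2)⁻¹ * 2)]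
    refine mul_le_mul_of_nonneg_left ?_ (by positivity)
    refine (ContinuousLinearMap.opNorm_comp_le _ _).trans ?_
    rw [innerSL_apply_norm]
    exact mul_le_of_le_one_right (norm_nonneg _) hsnd
  have hd := ((d1.mul d2).mul d3).fderiv
  change fderiv ℝ (stripCutoff a J) w = (Real.smoothTransition (J * (a - w.1) - 1) *
    Real.smoothTransition (J * (a + w.1) - 1)) • _ + _ at hd
  rw [mul_smul] at hd
  have hD : ‖fderiv ℝ (stripCutoff a J) w‖ ≤ _ := hd ▸ (norm_add_le _ _).trans (add_le_add
    ((hsm _ _).trans ((hsm _ _).trans m3))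
    ((hsm _ _).trans ((norm_add_le _ _).trans
      (add_le_add ((hsm _ _).trans m2) ((hsm _ _).trans m1)))))
  refine (mul_le_mul_of_nonneg_left (((gradD m).le_opNorm _).trans
    (mul_le_mul_of_nonneg_left hD (norm_nonneg _))) hw').trans ?_
  rw [mul_left_comm]
  refine mul_le_mul_of_nonneg_left ?_ (norm_nonneg _)
  linarith

end CutoffFunctions

/-! ### Removal of the cutoff and the reproducing property -/

section Reproducing

variable {m : ℕ} {a : ℝ}

/-- Hölder's inequality for two square integrable factors. Up to constants this product dominates
the integrands of both limits below. -/
theorem integrableOn_decay_mul_norm (hm : 1 ≤ m) {f : Para m → Cl m} (hf : MemA2 a f)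
    (y : EuclideanSpace ℝ (Fin m)) :
    IntegrableOn (fun w => decay m ‖w.2 - y‖ * ‖f w‖) (strip m a) :=
  (memLp_decay hm y).integrable_mul hf.2.norm

theorem tendsto_integral_cutoff_smul (hm : 1 ≤ m) {f : Para m → Cl m} (hf : MemA2 a f)
    {x : Para m} (hx : x ∈ strip m a) {χ : ℕ → Para m → ℝ} (hχ : ∀ j, Continuous (χ j))
    (h1 : ∀ j w, |χ j w| ≤ 1) (hev : ∀ w ∈ strip m a, ∀ᶠ j in atTop, χ j w = 1) :
    Tendsto (fun j => ∫ w in strip m a, χ j w • (conj (stripKernel a w x) * f w)) atTop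
      (𝓝 (∫ w in strip m a, conj (stripKernel a w x) * f w)) := by
  have hS : MeasurableSet (strip m a) := (isOpen_strip m a).measurableSet
  obtain ⟨C₁, hC₁, hB⟩ := norm_stripKernel_le hm hx
  have hKc : ContinuousOn (fun w => conj (stripKernel a w x)) (strip m a) :=
    (conjL m).continuous.comp_continuousOn (leftMonogenicOn_stripKernel hm hx).1.continuousOn
  refine tendsto_integral_of_dominated_convergence
    (fun w => ‖mulL m‖ * C₁ * (decay m ‖w.2 - x.2‖ * ‖f w‖)) (fun j => ?_)
    ((integrableOn_decay_mul_norm hm hf x.2).const_mul _) (fun j => ?_) ?_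
  · exact ((hχ j).continuousOn.smul
      (continuousOn_mul hKc hf.1.1.continuousOn)).aestronglyMeasurable hS
  · filter_upwards [ae_restrict_mem hS] with w hw
    rw [norm_smul]
    calc _ ≤ 1 * (‖mulL m‖ * ‖conj (stripKernel a w x)‖ * ‖f w‖) := by
          gcongr
          · exact h1 j w
          · exact norm_mul_le_mulL _ _
      _ ≤ 1 * (‖mulL m‖ * (C₁ * decay m ‖w.2 - x.2‖) * ‖f w‖) := by
          rw [norm_conj]; gcongr; exact hB w hw
      _ = _ := by ring
  · filter_upwards [ae_restrict_mem hS] with w hw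
    refine tendsto_const_nhds.congr' ?_
    filter_upwards [hev w hw] with j hj
    rw [hj, one_smul]

/-- The weight a - |w_0| absorbs the growth of the gradients, and at each fixed point the gradient
is eventually zero. -/
theorem tendsto_integral_cutoff_error (hm : 1 ≤ m) {f : Para m → Cl m} (hf : MemA2 a f)
    (y : EuclideanSpace ℝ (Fin m)) {χ : ℕ → Para m → ℝ} (hχ : ∀ j, ContDiff ℝ 1 (χ j)) {C : ℝ}
    (h1 : ∀ j, ∀ w ∈ strip m a, (a - |w.1|) * ‖gradD m (fderiv ℝ (χ j) w)‖ ≤ C)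
    (hev : ∀ w ∈ strip m a, ∀ᶠ j in atTop, fderiv ℝ (χ j) w = 0) :
    Tendsto (fun j => ∫ w in strip m a, (a - |w.1|) * decay m ‖w.2 - y‖ *
      (‖gradD m (fderiv ℝ (χ j) w)‖ * ‖f w‖)) atTop (𝓝 0) := by
  have hS : MeasurableSet (strip m a) := (isOpen_strip m a).measurableSet
  rw [← integral_zero (Para m) ℝ (μ := volume.restrict (strip m a))]
  refine tendsto_integral_of_dominated_convergence
    (fun w => C * (decay m ‖w.2 - y‖ * ‖f w‖)) (fun j => ?_)
    ((integrableOn_decay_mul_norm hm hf y).const_mul _) (fun j => ?_) ?_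
  · refine ContinuousOn.aestronglyMeasurable ?_ hS
    exact ((by fun_prop : Continuous fun w : Para m => a - |w.1|).mul
      (continuous_decay y)).continuousOn.mul (((gradD m).continuous.comp
        ((hχ j).continuous_fderiv one_ne_zero)).norm.continuousOn.mul hf.1.1.continuousOn.norm)
  · filter_upwards [ae_restrict_mem hS] with w hw
    have h2 : 0 ≤ a - |w.1| := sub_nonneg.2 (show |w.1| < a from hw).le
    have h3 := decay_nonneg (m := m) (norm_nonneg (w.2 - y))
    rw [Real.norm_of_nonneg (by positivity)]
    calc _ = ((a - |w.1|) * ‖gradD m (fderiv ℝ (χ j) w)‖) * (decay m ‖w.2 - y‖ * ‖f w‖) := by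
          ring
      _ ≤ _ := by gcongr; exact h1 j w hw
  · filter_upwards [ae_restrict_mem hS] with w hw
    refine tendsto_const_nhds.congr' ?_
    filter_upwards [hev w hw] with j hj
    rw [hj]; simp

theorem eventually_cutoff_large {b : ℝ} (hb : b < a) (R : ℝ) : ∀ᶠ j : ℕ in atTop,
    2 ≤ ((j : ℝ) + 1) * (a - b) ∧ R ≤ (j : ℝ) + 1 := by
  have t := tendsto_atTop_add_const_right atTop (1 : ℝ) (tendsto_natCast_atTop_atTop (R := ℝ))
  exact ((t.atTop_mul_const (sub_pos.2 hb)).eventually_ge_atTop 2).and (t.eventually_ge_atTop R)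

theorem stripKernel_reproducing (hm : 1 ≤ m) {f : Para m → Cl m} (hf : MemA2 a f) {x : Para m}
    (hx : x ∈ strip m a) : f x = ∫ w in strip m a, conj (stripKernel a w x) * f w := by
  have hxa : |x.1| < a := hx
  have ha : 0 < a := (abs_nonneg _).trans_lt hxa
  -- Fixing b fixes the constant of the cutoff error, which then does not depend on the cutoff; all
  -- late cutoffs are constant on the part of |w_0| < b within unit distance of x̲.
  obtain ⟨b, hxb, hba⟩ := exists_between hxa
  obtain ⟨C, hC⟩ := exists_norm_sub_integral_le hm hxb hba
  obtain ⟨C₂, hC₂, hχ₂⟩ := exists_mul_norm_fderiv_stripCutoff_le m ha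
  have hJ : ∀ j : ℕ, (0 : ℝ) < j + 1 := fun j => by positivity
  have hev : ∀ w ∈ strip m a, ∀ᶠ j : ℕ in atTop,
      stripCutoff a ((j : ℝ) + 1) w = 1 ∧ fderiv ℝ (stripCutoff a ((j : ℝ) + 1)) w = 0 :=
    fun w hw => by
      obtain ⟨b', hwb', hb'⟩ := exists_between (show |w.1| < a from hw)
      filter_upwards [eventually_cutoff_large hb' (‖w.2‖ + 1)] with j hj
      exact ⟨stripCutoff_eq_one (hJ j) hj.1 hj.2 hwb'.le (by linarith),
        fderiv_stripCutoff_eq_zero (hJ j) hj.1 hj.2 hwb' (by linarith)⟩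
  have hle := (eventually_cutoff_large hba (‖x.2‖ + 1)).mono fun j hj =>
    hC f hf.1 (stripCutoff a ((j : ℝ) + 1)) (contDiff_stripCutoff _ _)
      (hasCompactSupport_stripCutoff (hJ j)) (tsupport_stripCutoff_subset_strip (hJ j))
      fun w h1 h2 => fderiv_stripCutoff_eq_zero (hJ j) hj.1 hj.2 h1 (by
        have := norm_sub_norm_le w.2 x.2
        linarith)
  have lim1 := tendsto_integral_cutoff_smul hm hf hx
    (fun j : ℕ => (contDiff_stripCutoff a ((j : ℝ) + 1)).continuous)
    (fun j => abs_stripCutoff_le_one _) fun w hw => (hev w hw).mono fun _ h => h.1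
  have lim2 := tendsto_integral_cutoff_error hm hf x.2
    (fun j : ℕ => contDiff_stripCutoff a ((j : ℝ) + 1))
    (fun j => hχ₂ _ (by linarith [(Nat.cast_nonneg j : (0 : ℝ) ≤ j)]))
    fun w hw => (hev w hw).mono fun _ h => h.2
  have lim3 : Tendsto (fun j : ℕ => stripCutoff a ((j : ℝ) + 1) x • f x) atTop (𝓝 (f x)) := by
    refine tendsto_const_nhds.congr' ?_
    filter_upwards [hev x hx] with j hj
    rw [hj.1, one_smul]
  have h0 := le_of_tendsto_of_tendsto (lim3.sub lim1).norm (lim2.const_mul C) hle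
  rw [mul_zero] at h0
  exact sub_eq_zero.1 (norm_le_zero_iff.1 h0)

theorem isBergmanKernel_stripKernel (hm : 1 ≤ m) (a : ℝ) :
    IsBergmanKernel m a (stripKernel a) where
  mem _ hx := memA2_stripKernel hm hx
  reproducing _ hf _ hx := stripKernel_reproducing hm hf hx

end Reproducing

end StripBergman

end

theorem lemma3p9 (m : ℕ) (hm : 1 ≤ m) (a : ℝ) (ha : 0 < a) :
    (∃ B : StripBergman.Para m → StripBergman.Para m → StripBergman.Cl m,
      StripBergman.IsBergmanKernel m a B) ∧
    ∃ c C M : ℝ, 0 < c ∧ 0 < C ∧ 0 < M ∧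
      ∀ B : StripBergman.Para m → StripBergman.Para m → StripBergman.Cl m,
        StripBergman.IsBergmanKernel m a B →
        (∀ x ∈ StripBergman.strip m a, ∃ b : ℝ,
          B x x = (b : ℂ) • (1 : StripBergman.Cl m) ∧
          c / (a - |x.1|) ^ (m + 1) ≤ b ∧ b ≤ C / (a - |x.1|) ^ (m + 1)) ∧
        (Odd m → ∀ w ∈ StripBergman.strip m a, ∀ x ∈ StripBergman.strip m a,
          1 ≤ ‖w.2 - x.2‖ →
          ‖B w x‖ ≤ M / (‖w.2 - x.2‖ ^ (((m : ℝ) - 1) / 2) *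
            (2 * a - |w.1 + x.1|) ^ (((m : ℝ) + 3) / 2))) ∧
        (Even m → ∀ w ∈ StripBergman.strip m a, ∀ x ∈ StripBergman.strip m a,
          1 ≤ ‖w.2 - x.2‖ →
          ‖B w x‖ ≤ M / (‖w.2 - x.2‖ ^ (((m : ℝ) - 1) / 2) *
            (2 * a - |w.1 + x.1|) ^ (((m : ℝ) + 4) / 2))) := by
  have hB := StripBergman.isBergmanKernel_stripKernel hm a
  refine ⟨⟨_, hB⟩, ?_⟩
  have hσ := StripBergman.sigma_pos m
  have hm0 : (0 : ℝ) < m := by exact_mod_cast hm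
  have hZ : 0 < ∑' n : ℤ, (1 + |(n : ℝ)|) ^ (-(2 : ℝ)) :=
    StripBergman.summable_two.tsum_pos (fun n => by positivity) 0 (by positivity)
  obtain ⟨M₁, hM₁, h₁⟩ := StripBergman.norm_stripKernel_le_rpow hm ha (((m : ℝ) + 3) / 2)
    (by positivity)
  obtain ⟨M₂, hM₂, h₂⟩ := StripBergman.norm_stripKernel_le_rpow hm ha (((m : ℝ) + 4) / 2)
    (by positivity)
  have hpos : ∀ w ∈ StripBergman.strip m a, ∀ x ∈ StripBergman.strip m a, ∀ p : ℝ,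
      0 ≤ ‖w.2 - x.2‖ ^ (((m : ℝ) - 1) / 2) * (2 * a - |w.1 + x.1|) ^ p := fun w hw x hx p => by
    have h1 := StripBergman.abs_fst_add_le (x := x) hw
    have h2 : |x.1| < a := hx
    exact mul_nonneg (Real.rpow_nonneg (norm_nonneg _) _) (Real.rpow_nonneg (by linarith) _)
  refine ⟨2 * m / StripBergman.sigma m * 2⁻¹ ^ (m + 1), 2 * m / StripBergman.sigma m *
    ((3 / 2) ^ (m + 1) * ∑' n : ℤ, (1 + |(n : ℝ)|) ^ (-(2 : ℝ))), max M₁ M₂, by positivity,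
    by positivity, lt_max_of_lt_left hM₁, fun B hB' => ⟨fun x hx => ?_, fun _ w hw x hx hr => ?_,
      fun _ w hw x hx hr => ?_⟩⟩
  · obtain ⟨h1, h2, h3⟩ := StripBergman.stripKernel_self hm hx
    refine ⟨_, ?_, h2, h3⟩
    -- Uniqueness transfers the estimates of the explicit kernel to any Bergman kernel, so the
    -- constants do not depend on B.
    rw [hB'.unique hB hx hx, h1]
    exact (Complex.coe_smul _ _).symm
  · rw [hB'.unique hB hw hx]
    exact (h₁ w hw x hx hr).trans (div_le_div_of_nonneg_right (le_max_left _ _) (hpos w hw x hx _))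
  · rw [hB'.unique hB hw hx]
    exact (h₂ w hw x hx hr).trans (div_le_div_of_nonneg_right (le_max_right _ _) (hpos w hw x hx _))
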